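/- Let $\mathbf{k}$ be an algebraically closed field, let $U$ be a finite-dimensional $\mathbf{k}$-vector space, and let $R=\bigoplus_{m\ge 0}R_m$ be a graded quotient ring of $\mathrm{Sym}(U)$. For $n\ge 0$ let $R[n]=\bigoplus_{m\ge 0}R_{mn}$ be the $n$-th Veronese ring, with $R_{mn}$ placed in degree $m$, regarded as a graded module over $\mathrm{Sym}(R_n)$, and let $\mathbf{k}$ be a $\mathrm{Sym}(R_n)$-module via $\mathrm{Sym}(R_n)\to\mathbf{k}$, $R_n\mapsto 0$. Let $\mathrm{D}^dU=\mathrm{Sym}^d(U^*)^*\subseteq U^{\otimes d}$ be the space of symmetric tensors (the $d$-th divided power), so that $\mathrm{Sym}(\mathrm{D}^dU)$ is the ring of polynomial functions on $\mathrm{Sym}^d(U^*)$, and let $Y_d\subseteq\mathrm{Sym}^d(U^*)$ be the affine cone over the Chow variety, i.e. the set of all forms $c\,\ell_1\cdots\ell_d$ with $c\in\mathbf{k}$ and $\ell_1,\dots,\ell_d\in U^*$. Fix integers $i,d\ge 0$ and put $$T=\bigoplus_{n\ge 0}\mathrm{Tor}_i^{\mathrm{Sym}(R_n)}(R[n],\mathbf{k})_d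 ,$$ where the subscript $d$ denotes the component of internal degree $d$. (1) There is a unique $\mathrm{Sym}(\mathrm{D}^dU)$-module structure on $T$, extending its $\mathbf{k}$-vector space structure, such that for every $u\in U$ the element $u^{\otimes d}\in\mathrm{D}^dU$ acts by the maps $$\mathrm{Tor}_i^{\mathrm{Sym}(R_n)}(R[n],\mathbf{k})_d\to\mathrm{Tor}_i^{\mathrm{Sym}(R_{n+1})}(R[n+1],\mathbf{k})_d$$ induced by multiplication by $u$, that is, by the ring homomorphism $\mathrm{Sym}(R_n)\to\mathrm{Sym}(R_{n+1})$ extending $u\colon R_n\to R_{n+1}$ together with the ring homomorphism $R[n]\to R[n+1]$ given by $u^m\colon R_{mn}\to R_{m(n+1)}$ in degree $m$. (2) With this structure, $T$ is a finitely generated $\mathrm{Sym}(\mathrm{D}^dU)$-module, and it is supported on $Y_d$: its support is contained in the closed subset of $\mathrm{Spec}\,\mathrm{Sym}(\mathrm{D}^dU)$ defined by the ideal of polynomial functions vanishing on $Y_d$. (3) Each $\mathrm{Tor}_i^{\mathrm{Sym}(R_n)}(R[n],\mathbf{k})_d$ is finite-dimensional, and there is a polynomial $P\in\mathbf{Q}[x]$,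 which is zero or of degree at most $(\dim U-1)d$, such that $\dim_{\mathbf{k}}\mathrm{Tor}_i^{\mathrm{Sym}(R_n)}(R[n],\mathbf{k})_d=P(n)$ for all sufficiently large $n$. -/

import Mathlib

open scoped TensorProduct DirectSum

universe u v

noncomputable section

/-! ## Graded Tor against the residue field

`S` is a commutative graded algebra over a field `k` with an augmentation `ε : S → k`, and `M` is
a graded `S`-module.  The iterated tensor products over `k`, `T 0 = M` and `T (p + 1) = S ⊗ T p`,
are `S`-modules through their first factor, and

`⋯ → S ⊗ T 2 → S ⊗ T 1 → S ⊗ T 0 → M → 0`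

is the (unnormalised) bar resolution of `M` by the graded free `S`-modules `S ⊗ T p`; it is
functorial in the pair `(S, M)`.  Applying `k ⊗_S -` gives the complex `⋯ → T 2 → T 1 → T 0`,
whose homology is `Tor^S(M, k)` with its internal grading. -/

/-- The action map `S ⊗ T → T` of an `S`-module `T`. -/
def actionMap (k : Type u) (S T : Type v) [Field k] [CommRing S] [Algebra k S]
    [AddCommGroup T] [Module k T] [Module S T] [IsScalarTower k S T] : S ⊗[k] T →ₗ[k] T :=
  TensorProduct.lift (Algebra.lsmul k k T).toLinearMap

/-- One stage of the bar resolution: an `S`-module `T`, its homogeneous pieces, and the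
differential `S ⊗ T → T` of the bar resolution. -/
structure BarStage (k : Type u) (S : Type v) [Field k] [CommRing S] [Algebra k S] where
  carrier : Type v
  [addCommGroup : AddCommGroup carrier]
  [moduleBase : Module k carrier]
  [moduleRing : Module S carrier]
  [isScalarTower : IsScalarTower k S carrier]
  deg : ℕ → Submodule k carrier
  res : S ⊗[k] carrier →ₗ[k] carrier

attribute [instance] BarStage.addCommGroup BarStage.moduleBase BarStage.moduleRing
  BarStage.isScalarTower

namespace BarStage

variable {k : Type u} {S : Type v} [Field k] [CommRing S] [Algebra k S]

/-- The grading of `S ⊗ T`: the piece of degree `d` is spanned by the `s ⊗ x` with `s` and `x`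
homogeneous of degrees adding up to `d`. -/
def tensorDeg (𝒮 : ℕ → Submodule k S) (B : BarStage k S) (d : ℕ) :
    Submodule k (S ⊗[k] B.carrier) :=
  ⨆ (a : ℕ) (b : ℕ) (_ : a + b = d),
    Submodule.map₂ (TensorProduct.mk k S B.carrier) (𝒮 a) (B.deg b)

/-- From `T` to `S ⊗ T`; the differential `S ⊗ (S ⊗ T) → S ⊗ T` is `s ⊗ y ↦ s • y - s ⊗ D y`
where `D : S ⊗ T → T` is the previous differential. -/
def next (𝒮 : ℕ → Submodule k S) (B : BarStage k S) : BarStage k S where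
  carrier := S ⊗[k] B.carrier
  deg := B.tensorDeg 𝒮
  res := actionMap k S (S ⊗[k] B.carrier) - LinearMap.lTensor S B.res

/-- The contraction `s ⊗ x ↦ ε s • x`, i.e. the projection `S ⊗ T → k ⊗_S (S ⊗ T) = T`. -/
def contraction (ε : S →ₐ[k] k) (B : BarStage k S) : S ⊗[k] B.carrier →ₗ[k] B.carrier :=
  (TensorProduct.lid k B.carrier).toLinearMap ∘ₗ LinearMap.rTensor B.carrier ε.toLinearMap

/-- The differential `S ⊗ T → T` obtained from `S ⊗ (S ⊗ T) → S ⊗ T` by applying `k ⊗_S -`: the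
latter sends `1 ⊗ x` to `x - 1 ⊗ D x`, whose class in `k ⊗_S (S ⊗ T) = T` is this one. -/
def diff (ε : S →ₐ[k] k) (B : BarStage k S) : S ⊗[k] B.carrier →ₗ[k] B.carrier :=
  B.contraction ε - B.res

end BarStage

open BarStage

section Tor

variable {k : Type u} {S M : Type v} [Field k] [CommRing S] [Algebra k S]
  [AddCommGroup M] [Module k M] [Module S M] [IsScalarTower k S M]

/-- The stage `T p = S ⊗ ⋯ ⊗ S ⊗ M` (with `p` factors `S`) of the bar resolution of `M`. The
differential `S ⊗ M → M` is the action of `S` on `M`. -/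
def bar (𝒮 : ℕ → Submodule k S) (ℳ : ℕ → Submodule k M) : ℕ → BarStage k S
  | 0 => { carrier := M, deg := ℳ, res := actionMap k S M }
  | p + 1 => (bar 𝒮 ℳ p).next 𝒮

/-- Cycles of internal degree `d` in `T p`. -/
def torCycles (ε : S →ₐ[k] k) (𝒮 : ℕ → Submodule k S) (ℳ : ℕ → Submodule k M) :
    ∀ p : ℕ, ℕ → Submodule k (bar 𝒮 ℳ p).carrier
  | 0, d => ℳ d
  | p + 1, d => ((bar 𝒮 ℳ p).tensorDeg 𝒮 d ⊓ LinearMap.ker ((bar 𝒮 ℳ p).diff ε) :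
      Submodule k (S ⊗[k] (bar 𝒮 ℳ p).carrier))

/-- Boundaries of internal degree `d` in `T p`. -/
def torBoundaries (ε : S →ₐ[k] k) (𝒮 : ℕ → Submodule k S) (ℳ : ℕ → Submodule k M) (p d : ℕ) :
    Submodule k (bar 𝒮 ℳ p).carrier :=
  ((bar 𝒮 ℳ p).tensorDeg 𝒮 d).map ((bar 𝒮 ℳ p).diff ε)

/-- `Tor_p^S(M, k)_d`, where `k` is an `S`-module through `ε`. -/
abbrev GradedTor (ε : S →ₐ[k] k) (𝒮 : ℕ → Submodule k S) (ℳ : ℕ → Submodule k M) (p d : ℕ) :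
    Type v :=
  torCycles ε 𝒮 ℳ p d ⧸ (torBoundaries ε 𝒮 ℳ p d).submoduleOf (torCycles ε 𝒮 ℳ p d)

end Tor

/-! The bar resolution is an exact complex of free `S`-modules: its differentials are `S`-linear
and compose to zero, and `x ↦ 1 ⊗ x` is a contracting homotopy. -/

section Exact

variable {k : Type u} {S M : Type v} [Field k] [CommRing S] [Algebra k S]
  [AddCommGroup M] [Module k M] [Module S M] [IsScalarTower k S M]

theorem actionMap_smul (T : Type v) [AddCommGroup T] [Module k T] [Module S T]
    [IsScalarTower k S T] (s : S) (x : S ⊗[k] T) :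
    actionMap k S T (s • x) = s • actionMap k S T x := by
  induction x using TensorProduct.induction_on with
  | zero => simp
  | add x y hx hy => rw [smul_add, map_add, map_add, hx, hy, smul_add]
  | tmul t m => simp [actionMap, TensorProduct.smul_tmul']

theorem lTensor_smul_aux {T T' : Type v} [AddCommGroup T] [Module k T] [AddCommGroup T']
    [Module k T'] (f : T →ₗ[k] T') (s : S) (x : S ⊗[k] T) :
    LinearMap.lTensor S f (s • x) = s • LinearMap.lTensor S f x := by
  induction x using TensorProduct.induction_on with
  | zero => simp
  | add x y hx hy => rw [smul_add, map_add, map_add, hx, hy, smul_add]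
  | tmul t m => simp [TensorProduct.smul_tmul']

theorem BarStage.res_next_tmul (𝒮 : ℕ → Submodule k S) (B : BarStage k S) (s : S)
    (y : S ⊗[k] B.carrier) :
    (B.next 𝒮).res (s ⊗ₜ[k] (y : (B.next 𝒮).carrier))
      = (s • y - s ⊗ₜ[k] B.res y : S ⊗[k] B.carrier) := by
  change (actionMap k S (S ⊗[k] B.carrier) - LinearMap.lTensor S B.res) (s ⊗ₜ[k] y) = _
  simp [actionMap]

theorem bar_res_smul (𝒮 : ℕ → Submodule k S) (ℳ : ℕ → Submodule k M) (p : ℕ) (s : S)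
    (x : S ⊗[k] (bar 𝒮 ℳ p).carrier) :
    (bar 𝒮 ℳ p).res (s • x) = s • (bar 𝒮 ℳ p).res x := by
  cases p with
  | zero =>
    have h : ∀ x : S ⊗[k] M, actionMap k S M (s • x) = s • actionMap k S M x :=
      actionMap_smul M s
    exact h x
  | succ p =>
    have h : ∀ (B : BarStage k S) (x : S ⊗[k] (S ⊗[k] B.carrier)),
        (actionMap k S (S ⊗[k] B.carrier) - LinearMap.lTensor S B.res) (s • x)
        = s • (actionMap k S (S ⊗[k] B.carrier) - LinearMap.lTensor S B.res) x := by
      intro B x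
      rw [LinearMap.sub_apply, LinearMap.sub_apply, smul_sub, actionMap_smul, lTensor_smul_aux]
    exact h (bar 𝒮 ℳ p) x

theorem bar_res_res (𝒮 : ℕ → Submodule k S) (ℳ : ℕ → Submodule k M) (p : ℕ)
    (x : S ⊗[k] (bar 𝒮 ℳ (p + 1)).carrier) :
    (bar 𝒮 ℳ p).res ((bar 𝒮 ℳ (p + 1)).res x : S ⊗[k] (bar 𝒮 ℳ p).carrier) = 0 := by
  have red : ∀ B : BarStage k S, (∀ (s : S) (x : S ⊗[k] B.carrier),
      B.res (s • x) = B.res (s ⊗ₜ[k] B.res x)) →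
      B.res ∘ₗ (actionMap k S (S ⊗[k] B.carrier) - LinearMap.lTensor S B.res) = 0 := by
    intro B hB
    refine TensorProduct.ext' fun s y => ?_
    simp [actionMap, hB]
  induction p with
  | zero =>
    refine LinearMap.congr_fun (red (bar 𝒮 ℳ 0) fun s y => ?_) x
    rw [bar_res_smul]
    rfl
  | succ p ih =>
    refine LinearMap.congr_fun (red (bar 𝒮 ℳ (p + 1)) fun s y => ?_) x
    rw [bar_res_smul]
    refine Eq.trans ?_ (BarStage.res_next_tmul 𝒮 (bar 𝒮 ℳ p) s _).symm
    rw [ih y, TensorProduct.tmul_zero, sub_zero]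
    rfl

end Exact

/-! ### Functoriality in the pair `(S, M)` -/

section Functoriality

variable {k : Type u} {S S' M M' : Type v} [Field k]
  [CommRing S] [Algebra k S] [CommRing S'] [Algebra k S']
  [AddCommGroup M] [Module k M] [Module S M] [IsScalarTower k S M]
  [AddCommGroup M'] [Module k M'] [Module S' M'] [IsScalarTower k S' M']

/-- The map `φ ⊗ ⋯ ⊗ φ ⊗ f` from `S ⊗ ⋯ ⊗ S ⊗ M` to `S' ⊗ ⋯ ⊗ S' ⊗ M'`. -/
def barMap (𝒮 : ℕ → Submodule k S) (ℳ : ℕ → Submodule k M)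
    (𝒮' : ℕ → Submodule k S') (ℳ' : ℕ → Submodule k M') (φ : S →ₐ[k] S') (f : M →ₗ[k] M') :
    ∀ p : ℕ, (bar 𝒮 ℳ p).carrier →ₗ[k] (bar 𝒮' ℳ' p).carrier
  | 0 => f
  | p + 1 => TensorProduct.map φ.toLinearMap (barMap 𝒮 ℳ 𝒮' ℳ' φ f p)

/-- A linear map between two stages that is `φ`-semilinear, commutes with the differentials of the
bar resolutions, and respects the gradings. -/
structure BarStage.Compat (φ : S →ₐ[k] S') (B : BarStage k S) (B' : BarStage k S')
    (f : B.carrier →ₗ[k] B'.carrier) : Prop where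
  smul : ∀ s x, f (s • x) = φ s • f x
  res : ∀ x, f (B.res x) = B'.res (TensorProduct.map φ.toLinearMap f x)
  deg : ∀ d, ∀ x ∈ B.deg d, f x ∈ B'.deg d

theorem BarStage.Compat.tensorDeg {φ : S →ₐ[k] S'} {B : BarStage k S} {B' : BarStage k S'}
    {f : B.carrier →ₗ[k] B'.carrier} (h : Compat φ B B' f)
    {𝒮 : ℕ → Submodule k S} {𝒮' : ℕ → Submodule k S'} (hφ : ∀ d, ∀ s ∈ 𝒮 d, φ s ∈ 𝒮' d)
    (d : ℕ) (x : S ⊗[k] B.carrier) (hx : x ∈ B.tensorDeg 𝒮 d) :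
    TensorProduct.map φ.toLinearMap f x ∈ B'.tensorDeg 𝒮' d := by
  suffices H : B.tensorDeg 𝒮 d ≤ (B'.tensorDeg 𝒮' d).comap (TensorProduct.map φ.toLinearMap f) from
    H hx
  refine iSup_le fun a => iSup_le fun b => iSup_le fun hab => Submodule.map₂_le.2 fun s hs y hy => ?_
  refine (le_iSup_of_le a <| le_iSup_of_le b <| le_iSup_of_le hab le_rfl :
    Submodule.map₂ (TensorProduct.mk k S' B'.carrier) (𝒮' a) (B'.deg b) ≤ B'.tensorDeg 𝒮' d) ?_
  exact Submodule.apply_mem_map₂ _ (hφ a s hs) (h.deg b y hy)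

theorem BarStage.Compat.diff {φ : S →ₐ[k] S'} {B : BarStage k S} {B' : BarStage k S'}
    {f : B.carrier →ₗ[k] B'.carrier} (h : Compat φ B B' f) {ε : S →ₐ[k] k} {ε' : S' →ₐ[k] k}
    (hε : ε'.comp φ = ε) (x : S ⊗[k] B.carrier) :
    f (B.diff ε x) = B'.diff ε' (TensorProduct.map φ.toLinearMap f x) := by
  rw [BarStage.diff, BarStage.diff, LinearMap.sub_apply, LinearMap.sub_apply, map_sub, h.res]
  congr 1
  subst hε
  induction x using TensorProduct.induction_on with
  | zero => simp
  | add x y hx hy => simp only [map_add, hx, hy]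
  | tmul s y => simp [contraction]

theorem BarStage.Compat.next {φ : S →ₐ[k] S'} {B : BarStage k S} {B' : BarStage k S'}
    {f : B.carrier →ₗ[k] B'.carrier} (h : Compat φ B B' f)
    {𝒮 : ℕ → Submodule k S} {𝒮' : ℕ → Submodule k S'} (hφ : ∀ d, ∀ s ∈ 𝒮 d, φ s ∈ 𝒮' d) :
    Compat φ (B.next 𝒮) (B'.next 𝒮') (TensorProduct.map φ.toLinearMap f) := by
  have hs : ∀ (s : S) (x : S ⊗[k] B.carrier), TensorProduct.map φ.toLinearMap f (s • x)
      = φ s • TensorProduct.map φ.toLinearMap f x := by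
    intro s x
    induction x using TensorProduct.induction_on with
    | zero => simp
    | add x y hx hy => rw [smul_add, map_add, map_add, smul_add, hx, hy]
    | tmul t y => simp [TensorProduct.smul_tmul']
  refine ⟨hs, fun x => ?_, h.tensorDeg hφ⟩
  have key : TensorProduct.map φ.toLinearMap f ∘ₗ
      (actionMap k S (S ⊗[k] B.carrier) - LinearMap.lTensor S B.res)
      = (actionMap k S' (S' ⊗[k] B'.carrier) - LinearMap.lTensor S' B'.res) ∘ₗ
        TensorProduct.map φ.toLinearMap (TensorProduct.map φ.toLinearMap f) := by
    refine TensorProduct.ext' fun s y => ?_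
    simp [actionMap, hs, h.res]
  exact LinearMap.congr_fun key x

theorem barMap_compat {𝒮 : ℕ → Submodule k S} {ℳ : ℕ → Submodule k M}
    {𝒮' : ℕ → Submodule k S'} {ℳ' : ℕ → Submodule k M'} {φ : S →ₐ[k] S'} {f : M →ₗ[k] M'}
    (hφ : ∀ d, ∀ s ∈ 𝒮 d, φ s ∈ 𝒮' d) (hf : ∀ d, ∀ m ∈ ℳ d, f m ∈ ℳ' d)
    (hsmul : ∀ s m, f (s • m) = φ s • f m) (p : ℕ) :
    Compat φ (bar 𝒮 ℳ p) (bar 𝒮' ℳ' p) (barMap 𝒮 ℳ 𝒮' ℳ' φ f p) := by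
  induction p with
  | zero =>
    refine ⟨hsmul, fun x => ?_, hf⟩
    have key : f ∘ₗ actionMap k S M = actionMap k S' M' ∘ₗ TensorProduct.map φ.toLinearMap f := by
      refine TensorProduct.ext' fun s m => ?_
      simp [actionMap, hsmul]
    exact LinearMap.congr_fun key x
  | succ p ih => exact ih.next hφ

/-- The map `Tor_p^S(M, k)_d → Tor_p^{S'}(M', k)_d` induced by a homomorphism `φ : S → S'` of
graded augmented algebras and a `φ`-semilinear graded map `f : M → M'`. -/
def gradedTorMap {ε : S →ₐ[k] k} {ε' : S' →ₐ[k] k} {𝒮 : ℕ → Submodule k S}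
    {ℳ : ℕ → Submodule k M} {𝒮' : ℕ → Submodule k S'} {ℳ' : ℕ → Submodule k M'}
    (φ : S →ₐ[k] S') (f : M →ₗ[k] M') (hε : ε'.comp φ = ε)
    (hφ : ∀ d, ∀ s ∈ 𝒮 d, φ s ∈ 𝒮' d) (hf : ∀ d, ∀ m ∈ ℳ d, f m ∈ ℳ' d)
    (hsmul : ∀ s m, f (s • m) = φ s • f m) (p d : ℕ) :
    GradedTor ε 𝒮 ℳ p d →ₗ[k] GradedTor ε' 𝒮' ℳ' p d :=
  Submodule.mapQ _ _
    ((barMap 𝒮 ℳ 𝒮' ℳ' φ f p).restrict (p := torCycles ε 𝒮 ℳ p d)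
      (q := torCycles ε' 𝒮' ℳ' p d) (by
        cases p with
        | zero => exact hf d
        | succ p =>
          intro x hx
          have hc := barMap_compat hφ hf hsmul p
          refine ⟨hc.tensorDeg hφ d x hx.1, ?_⟩
          change (bar 𝒮' ℳ' p).diff ε' (TensorProduct.map φ.toLinearMap _ x) = 0
          have h0 : (bar 𝒮 ℳ p).diff ε x = 0 := hx.2
          exact (hc.diff hε x).symm.trans ((congrArg _ h0).trans (map_zero _))))
    (by
      rintro x ⟨y, hy, hyx⟩
      have hc := barMap_compat hφ hf hsmul p
      exact ⟨_, hc.tensorDeg hφ d y hy, (hc.diff hε y).symm.trans (congrArg _ hyx)⟩)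

end Functoriality

/-! ## Veronese subrings -/

section Veronese

variable {k R : Type u} [Field k] [CommRing R] [Algebra k R]

/-- The grading of a symmetric algebra: degree `e` is spanned by the products of `e` vectors. -/
def symDeg (k : Type u) (V : Type v) [Field k] [AddCommGroup V] [Module k V] (e : ℕ) :
    Submodule k (SymmetricAlgebra k V) :=
  LinearMap.range (SymmetricAlgebra.ι k V) ^ e

/-- The functoriality map `Sym V → Sym W` of a linear map `V → W`. -/
def symMap {V W : Type u} [AddCommGroup V] [Module k V] [AddCommGroup W] [Module k W]
    (g : V →ₗ[k] W) : SymmetricAlgebra k V →ₐ[k] SymmetricAlgebra k W :=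
  SymmetricAlgebra.lift (SymmetricAlgebra.ι k W ∘ₗ g)

variable (𝒜 : ℕ → Submodule k R) [GradedAlgebra 𝒜]

/-- The degree `m` piece `R_{mn}` of the `n`-th Veronese ring `R[n]`. -/
def veronesePiece (n m : ℕ) : Submodule k R := 𝒜 (m * n)

instance (n : ℕ) : SetLike.GradedMonoid (veronesePiece 𝒜 n) where
  one_mem := by
    change (1 : R) ∈ 𝒜 (0 * n)
    rw [zero_mul]
    exact SetLike.GradedOne.one_mem
  mul_mem a b x y hx hy := by
    change x * y ∈ 𝒜 ((a + b) * n)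
    rw [add_mul]
    exact SetLike.GradedMul.mul_mem hx hy

/-- The `n`-th Veronese ring `R[n] = ⨁ m, R_{mn}`, with `R_{mn}` in degree `m`. -/
def Veronese (n : ℕ) : Type u := ⨁ m, veronesePiece 𝒜 n m

instance (n : ℕ) : CommRing (Veronese 𝒜 n) :=
  inferInstanceAs (CommRing (⨁ m, veronesePiece 𝒜 n m))

instance (n : ℕ) : Algebra k (Veronese 𝒜 n) :=
  inferInstanceAs (Algebra k (⨁ m, veronesePiece 𝒜 n m))

/-- The inclusion of `R_{mn}` as the degree `m` piece of `R[n]`. -/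
def veroneseIncl (n m : ℕ) : veronesePiece 𝒜 n m →ₗ[k] Veronese 𝒜 n :=
  DirectSum.lof k ℕ (fun m => veronesePiece 𝒜 n m) m

/-- The grading of `R[n]`. -/
def veroneseDeg (n m : ℕ) : Submodule k (Veronese 𝒜 n) := LinearMap.range (veroneseIncl 𝒜 n m)

/-- The inclusion `R_n → R[n]` in degree one. -/
def veroneseOne (n : ℕ) : 𝒜 n →ₗ[k] Veronese 𝒜 n :=
  veroneseIncl 𝒜 n 1 ∘ₗ Submodule.inclusion (by rw [veronesePiece, one_mul])

/-- The homomorphism `Sym(R_n) → R[n]` that is the identity on `R_n`. -/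
def symToVeronese (n : ℕ) : SymmetricAlgebra k (𝒜 n) →ₐ[k] Veronese 𝒜 n :=
  SymmetricAlgebra.lift (veroneseOne 𝒜 n)

instance (n : ℕ) : Module (SymmetricAlgebra k (𝒜 n)) (Veronese 𝒜 n) :=
  Module.compHom _ (symToVeronese 𝒜 n).toRingHom

instance (n : ℕ) : IsScalarTower k (SymmetricAlgebra k (𝒜 n)) (Veronese 𝒜 n) where
  smul_assoc c s m := by
    change symToVeronese 𝒜 n (c • s) * m = c • (symToVeronese 𝒜 n s * m)
    rw [map_smul, smul_mul_assoc]

/-- `Tor_i^{Sym(R_n)}(R[n], k)_d`. -/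
abbrev VeroneseTor (i d n : ℕ) : Type u :=
  GradedTor (k := k) (S := SymmetricAlgebra k (𝒜 n)) (M := Veronese 𝒜 n)
    SymmetricAlgebra.algebraMapInv (symDeg k (𝒜 n)) (veroneseDeg 𝒜 n) i d

/-! ### Multiplication by an element of degree one

For `x ∈ R_1`, multiplication by `x` is a map `R_n → R_{n+1}`; it induces a homomorphism
`Sym(R_n) → Sym(R_{n+1})`.  It is compatible with the ring homomorphism `R[n] → R[n+1]` that is
multiplication by `x ^ m` in degree `m`. -/

/-- Multiplication by `x ^ m` as a map `R_{mn} → R_{m(n+1)}`. -/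
def pieceMul (x : 𝒜 1) (n m : ℕ) : veronesePiece 𝒜 n m →ₗ[k] veronesePiece 𝒜 (n + 1) m :=
  (LinearMap.mulLeft k ((x : R) ^ m)).restrict (by
    intro y hy
    change (x : R) ^ m * y ∈ 𝒜 (m * (n + 1))
    have h1 : (x : R) ^ m ∈ 𝒜 (m • 1) := SetLike.pow_mem_graded m x.2
    have h2 := SetLike.GradedMul.mul_mem (A := 𝒜) h1 hy
    have e : m • 1 + m * n = m * (n + 1) := by rw [smul_eq_mul]; ring
    rwa [e] at h2)

/-- Multiplication by `x` as a map `R_n → R_{n+1}`. -/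
def degMul (x : 𝒜 1) (n : ℕ) : 𝒜 n →ₗ[k] 𝒜 (n + 1) :=
  (LinearMap.mulLeft k (x : R)).restrict (by
    intro y hy
    have h2 := SetLike.GradedMul.mul_mem (A := 𝒜) x.2 hy
    rwa [add_comm] at h2)

/-- The ring homomorphism `R[n] → R[n+1]` that is multiplication by `x ^ m` in degree `m`. -/
def veroneseMul (x : 𝒜 1) (n : ℕ) : Veronese 𝒜 n →ₐ[k] Veronese 𝒜 (n + 1) :=
  DirectSum.toAlgebra k (fun m => veronesePiece 𝒜 n m)
    (fun m => veroneseIncl 𝒜 (n + 1) m ∘ₗ pieceMul 𝒜 x n m)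
    (by
      refine congrArg (veroneseIncl 𝒜 (n + 1) 0) (Subtype.ext ?_)
      change (x : R) ^ 0 * 1 = 1
      simp)
    (by
      intro a b y z
      have h : (veroneseIncl 𝒜 (n + 1) a (pieceMul 𝒜 x n a y) : Veronese 𝒜 (n + 1)) *
          veroneseIncl 𝒜 (n + 1) b (pieceMul 𝒜 x n b z)
          = veroneseIncl 𝒜 (n + 1) (a + b)
            ⟨(pieceMul 𝒜 x n a y : R) * pieceMul 𝒜 x n b z,
              SetLike.GradedMul.mul_mem (pieceMul 𝒜 x n a y).2 (pieceMul 𝒜 x n b z).2⟩ :=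
        DirectSum.of_mul_of (A := fun m => ↥(veronesePiece 𝒜 (n + 1) m))
          (pieceMul 𝒜 x n a y) (pieceMul 𝒜 x n b z)
      refine Eq.trans ?_ h.symm
      refine congrArg (veroneseIncl 𝒜 (n + 1) (a + b)) (Subtype.ext ?_)
      change (x : R) ^ (a + b) * ((y : R) * z) = (x : R) ^ a * y * ((x : R) ^ b * z)
      ring)

theorem veroneseMul_incl (x : 𝒜 1) (n m : ℕ) (y : veronesePiece 𝒜 n m) :
    veroneseMul 𝒜 x n (veroneseIncl 𝒜 n m y)
      = veroneseIncl 𝒜 (n + 1) m (pieceMul 𝒜 x n m y) :=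
  DirectSum.toModule_lof (R := k) (M := fun m => veronesePiece 𝒜 n m) (N := Veronese 𝒜 (n + 1))
    (φ := fun m => veroneseIncl 𝒜 (n + 1) m ∘ₗ pieceMul 𝒜 x n m) m y

theorem symMap_mem_symDeg {V W : Type u} [AddCommGroup V] [Module k V] [AddCommGroup W]
    [Module k W] (g : V →ₗ[k] W) (e : ℕ) (s : SymmetricAlgebra k V) (hs : s ∈ symDeg k V e) :
    symMap g s ∈ symDeg k W e := by
  have h : (LinearMap.range (SymmetricAlgebra.ι k V)).map (symMap g).toLinearMap
      ≤ LinearMap.range (SymmetricAlgebra.ι k W) := by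
    rintro _ ⟨_, ⟨v, rfl⟩, rfl⟩
    exact ⟨g v, by simp [symMap]⟩
  have h2 : symMap g s ∈ (LinearMap.range (SymmetricAlgebra.ι k V) ^ e).map
      (symMap g).toLinearMap := ⟨s, hs, rfl⟩
  rw [Submodule.map_pow] at h2
  exact pow_le_pow_left' h e h2

theorem veroneseMul_symToVeronese (x : 𝒜 1) (n : ℕ) :
    (veroneseMul 𝒜 x n).comp (symToVeronese 𝒜 n)
      = (symToVeronese 𝒜 (n + 1)).comp (symMap (degMul 𝒜 x n)) := by
  refine SymmetricAlgebra.algHom_ext (LinearMap.ext fun y => ?_)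
  change veroneseMul 𝒜 x n (symToVeronese 𝒜 n (SymmetricAlgebra.ι k (𝒜 n) y))
    = symToVeronese 𝒜 (n + 1) (symMap (degMul 𝒜 x n) (SymmetricAlgebra.ι k (𝒜 n) y))
  rw [symToVeronese, symToVeronese, symMap, SymmetricAlgebra.lift_ι_apply,
    SymmetricAlgebra.lift_ι_apply, LinearMap.comp_apply, SymmetricAlgebra.lift_ι_apply,
    veroneseOne, LinearMap.comp_apply, veroneseMul_incl]
  refine congrArg (veroneseIncl 𝒜 (n + 1) 1) (Subtype.ext ?_)
  change (x : R) ^ 1 * (y : R) = (x : R) * y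
  rw [pow_one]

/-- The map `Tor_i^{Sym(R_n)}(R[n], k)_d → Tor_i^{Sym(R_{n+1})}(R[n+1], k)_d` induced by
multiplication by `x ∈ R_1`. -/
def veroneseTorMap (x : 𝒜 1) (i d n : ℕ) : VeroneseTor 𝒜 i d n →ₗ[k] VeroneseTor 𝒜 i d (n + 1) :=
  gradedTorMap (symMap (degMul 𝒜 x n)) (veroneseMul 𝒜 x n).toLinearMap
    (SymmetricAlgebra.algHom_ext (LinearMap.ext fun y => by
      simp [symMap, SymmetricAlgebra.algebraMapInv]))
    (symMap_mem_symDeg (degMul 𝒜 x n))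
    (by
      rintro m _ ⟨y, rfl⟩
      exact ⟨_, (veroneseMul_incl 𝒜 x n m y).symm⟩)
    (by
      intro s m
      change veroneseMul 𝒜 x n (symToVeronese 𝒜 n s * m)
        = symToVeronese 𝒜 (n + 1) (symMap (degMul 𝒜 x n) s) * veroneseMul 𝒜 x n m
      rw [map_mul]
      congr 1
      exact AlgHom.congr_fun (veroneseMul_symToVeronese 𝒜 x n) s)
    i d

/-- `⨁ n ≥ 0, Tor_i^{Sym(R_n)}(R[n], k)_d`. -/
abbrev VeroneseTorSum (i d : ℕ) : Type u := ⨁ n, VeroneseTor 𝒜 i d n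

end Veronese

/-! ## Divided powers and the Chow variety -/

section Chow

variable (k : Type u) (U : Type v) [Field k] [AddCommGroup U] [Module k U]

/-- The divided power `D^d U = Sym^d(U^*)^*`: the symmetric tensors in `U ⊗ ⋯ ⊗ U` (`d` factors). -/
def dividedPower (d : ℕ) : Submodule k (⨂[k] _ : Fin d, U) :=
  ⨅ σ : Equiv.Perm (Fin d),
    LinearMap.eqLocus (PiTensorProduct.reindex k (fun _ : Fin d => U) σ).toLinearMap LinearMap.id

variable {U}

/-- The divided power `u^{[d]} = u ⊗ ⋯ ⊗ u ∈ D^d U` of a vector. -/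
def dpow (d : ℕ) (u : U) : dividedPower k U d :=
  ⟨PiTensorProduct.tprod k fun _ => u, by
    simp [dividedPower, Submodule.mem_iInf, LinearMap.mem_eqLocus]⟩

variable {k}

/-- The degree `d` form `ℓ₁ ⋯ ℓ_d` on `U`, as a point of `Sym^d(U^*) = (D^d U)^*`: the functional
`t ↦ (ℓ₁ ⊗ ⋯ ⊗ ℓ_d)(t)` on symmetric tensors. -/
def prodForm {d : ℕ} (ℓ : Fin d → Module.Dual k U) : Module.Dual k (dividedPower k U d) :=
  PiTensorProduct.lift ((MultilinearMap.mkPiAlgebra k (Fin d) k).compLinearMap ℓ) ∘ₗ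
    (dividedPower k U d).subtype

variable (k U)

/-- The affine cone over the Chow variety in `Sym^d(U^*) = (D^d U)^*`: the forms that decompose
into a product of linear factors, up to a scalar (which can be absorbed into a factor if `d ≥ 1`). -/
def chowVariety (d : ℕ) : Set (Module.Dual k (dividedPower k U d)) :=
  {F | ∃ (c : k) (ℓ : Fin d → Module.Dual k U), F = c • prodForm ℓ}

/-- The ideal of all polynomial functions `f ∈ Sym(D^d U) = k[Sym^d(U^*)]` that vanish on the Chow
variety; the value of `f` at the point `F : D^d U → k` is the extension of `F` to `Sym(D^d U)`. -/
def chowIdeal (d : ℕ) : Ideal (SymmetricAlgebra k (dividedPower k U d)) :=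
  ⨅ F ∈ chowVariety k U d, RingHom.ker (SymmetricAlgebra.lift F)

end Chow

section Action

variable {k R : Type u} {U : Type v} [Field k] [AddCommGroup U] [Module k U]
  [CommRing R] [Algebra k R] (𝒜 : ℕ → Submodule k R) [GradedAlgebra 𝒜]

/-- The action of `Sym(D^d U)` on `⨁ n, Tor_i^{Sym(R_n)}(R[n], k)_d` given by multiplication:
`u^{[d]}` acts by the maps `Tor_i^{Sym(R_n)}(R[n], k)_d → Tor_i^{Sym(R_{n+1})}(R[n+1], k)_d`
induced by multiplication by the image `g u ∈ R_1` of `u`. -/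
def IsMultiplicationAction (g : U →ₗ[k] 𝒜 1) (i d : ℕ)
    (ρ : SymmetricAlgebra k (dividedPower k U d) →ₐ[k] Module.End k (VeroneseTorSum 𝒜 i d)) :
    Prop :=
  ∀ (u : U) (n : ℕ) (x : VeroneseTor 𝒜 i d n),
    ρ (SymmetricAlgebra.ι k _ (dpow k d u)) (DirectSum.lof k ℕ (VeroneseTor 𝒜 i d) n x)
      = DirectSum.lof k ℕ (VeroneseTor 𝒜 i d) (n + 1) (veroneseTorMap 𝒜 (g u) i d n x)

end Action

end

/-!
The part of internal degree `d` of the bar complex computing `Tor^{Sym(R_n)}(R[n], k)` is spanned by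
the values of finitely many `d`-linear maps on `R_n`, since `Sym^a(R_n)` and `R_{a n} = (R_n)^a` are
spanned by products of `a` elements of `R_n`. As `R_n` is a quotient of the forms of degree `n` in
`dim U` variables, `Tor_i(R[n], k)_d` is a subquotient of finitely many copies of the space of
polynomials that are homogeneous of degree `n` in each of `d` groups of `dim U` variables, and on
these polynomials multiplication by `u ∈ U` becomes multiplication by the product of the `d` linear
forms given by `u` in the `d` groups of variables. That product is the value at `u^{⊗ d}` of a
linear map defined on all of `D^d U`, namely pullback along `(ℓ₁, …, ℓ_d) ↦ ℓ₁ ⋯ ℓ_d`; since the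
`u^{⊗ d}` span `D^d U`, this action of `D^d U` descends to the subquotient.

The multihomogeneous polynomials form a finitely generated module, because a product of linear forms
vanishes only if one of the factors does, and it is killed by the functions vanishing on products of
linear forms. Finite generation, the bound on the support and the Hilbert polynomial pass to the
subquotient by noetherianity; the number of multihomogeneous monomials bounds the degree.
-/

noncomputable section

open Filter

section EventuallyPolynomial

open Polynomial

/-- The function `h` agrees with a rational polynomial at all large arguments. -/
def EventuallyPolynomial (h : ℕ → ℚ) : Prop :=
  ∃ P : ℚ[X], ∀ᶠ n : ℕ in atTop, h n = P.eval (n : ℚ)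

theorem eventuallyPolynomial_zero : EventuallyPolynomial fun _ => 0 :=
  ⟨0, .of_forall fun _ => eval_zero.symm⟩

theorem EventuallyPolynomial.congr {h h' : ℕ → ℚ} (H : EventuallyPolynomial h)
    (hh : h =ᶠ[atTop] h') : EventuallyPolynomial h' := by
  obtain ⟨P, hP⟩ := H
  exact ⟨P, by filter_upwards [hP, hh] with n h1 h2; rw [← h2, h1]⟩

theorem EventuallyPolynomial.sub {h h' : ℕ → ℚ} (H : EventuallyPolynomial h)
    (H' : EventuallyPolynomial h') : EventuallyPolynomial fun n => h n - h' n := by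
  obtain ⟨P, hP⟩ := H
  obtain ⟨Q, hQ⟩ := H'
  exact ⟨P - Q, by filter_upwards [hP, hQ] with n h1 h2; rw [eval_sub, h1, h2]⟩

theorem EventuallyPolynomial.comp_add_one {h : ℕ → ℚ} (H : EventuallyPolynomial h) :
    EventuallyPolynomial fun n => h (n + 1) := by
  obtain ⟨P, hP⟩ := H
  refine ⟨P.comp (X + 1), ?_⟩
  filter_upwards [(tendsto_add_atTop_nat 1).eventually hP] with n hn
  simp [hn]

theorem exists_eval_add_one_sub_eval_eq (P : ℚ[X]) :
    ∃ Q : ℚ[X], ∀ x, Q.eval (x + 1) - Q.eval x = P.eval x := by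
  induction P using Polynomial.induction_on' with
  | add P P' hP hP' =>
    obtain ⟨Q, hQ⟩ := hP
    obtain ⟨Q', hQ'⟩ := hP'
    exact ⟨Q + Q', fun x => by rw [eval_add, eval_add, eval_add, ← hQ, ← hQ']; ring⟩
  | monomial n a =>
    -- the Bernoulli polynomials satisfy `B (x + 1) - B x = (n + 1) x ^ n` in degree `n + 1`
    refine ⟨C (a / (n + 1)) * Polynomial.bernoulli (n + 1), fun x => ?_⟩
    have hn : (n : ℚ) + 1 ≠ 0 := by positivity
    have h := bernoulli_eval_one_add (n + 1) x
    rw [Nat.add_sub_cancel, Nat.cast_add_one] at h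
    rw [add_comm x 1, eval_C_mul, eval_C_mul, h, eval_monomial]
    field_simp
    ring

theorem EventuallyPolynomial.of_sub {h : ℕ → ℚ}
    (H : EventuallyPolynomial fun n => h (n + 1) - h n) : EventuallyPolynomial h := by
  obtain ⟨P, hP⟩ := H
  obtain ⟨Q, hQ⟩ := exists_eval_add_one_sub_eval_eq P
  obtain ⟨N, hN⟩ := eventually_atTop.1 hP
  refine ⟨Q + C (h N - Q.eval (N : ℚ)), eventually_atTop.2 ⟨N, fun n hn => ?_⟩⟩
  induction n, hn using Nat.le_induction with
  | base => simp
  | succ n hn ih =>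
    rw [eval_add, eval_C] at ih ⊢
    push_cast
    linarith [hN n hn, hQ n]

theorem natDegree_le_of_eventually_eval_le {P : ℚ[X]} {c e : ℕ}
    (hP : ∀ᶠ n : ℕ in atTop, 0 ≤ P.eval (n : ℚ) ∧ P.eval (n : ℚ) ≤ c * (n + 1) ^ e) :
    P.natDegree ≤ e := by
  by_contra! hlt
  have hP0 : P ≠ 0 := ne_zero_of_natDegree_gt hlt
  let Q : ℚ[X] := C (c : ℚ) * (X + C 1) ^ e
  have hQ : Q.natDegree ≤ e :=
    (natDegree_C_mul_le _ _).trans (natDegree_pow_le.trans (by rw [natDegree_X_add_C, mul_one]))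
  have hdeg : Q.degree < P.degree := degree_lt_degree (hQ.trans_lt hlt)
  have hcast := tendsto_natCast_atTop_atTop (R := ℚ)
  have hdiv : ∀ᶠ n : ℕ in atTop, Q.eval (n : ℚ) / P.eval (n : ℚ) < 1 :=
    hcast.eventually ((Q.div_tendsto_atTop_zero_of_degree_lt P hdeg).eventually_lt_const one_pos)
  have hroot := hcast.eventually (eventually_atTop_not_isRoot P hP0)
  obtain ⟨n, ⟨hnonneg, hle⟩, hroot, hdiv⟩ := (hP.and (hroot.and hdiv)).exists
  rw [div_lt_one (lt_of_le_of_ne hnonneg (Ne.symm hroot))] at hdiv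
  exact hdiv.not_ge (by simpa [Q] using hle)

theorem eq_zero_of_eventually_eval_eq_zero {P : ℚ[X]}
    (hP : ∀ᶠ n : ℕ in atTop, P.eval (n : ℚ) = 0) : P = 0 := by
  by_contra hP0
  have hroot := (tendsto_natCast_atTop_atTop (R := ℚ)).eventually
    (eventually_atTop_not_isRoot P hP0)
  obtain ⟨n, h, h'⟩ := (hP.and hroot).exists
  exact h' h

end EventuallyPolynomial

section HilbertFunction

section StableFamily

variable {k ι : Type*} [Semiring k] {V : ℕ → Type*} [∀ n, AddCommMonoid (V n)]
  [∀ n, Module k (V n)]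

/-- The image of a graded subspace under an operator `z` of degree one, as a graded subspace. -/
def shiftImage (z : ∀ n, V n →ₗ[k] V (n + 1)) (N : ∀ n, Submodule k (V n)) :
    ∀ n, Submodule k (V n)
  | 0 => ⊥
  | n + 1 => (N n).map (z n)

/-- A graded subspace that is stable under operators `y i` of degree one, i.e. a graded submodule
over the polynomial ring with one variable of degree one for each `i`. -/
def IsStableFamily (y : ι → ∀ n, V n →ₗ[k] V (n + 1)) (N : ∀ n, Submodule k (V n)) : Prop :=
  ∀ i, shiftImage (y i) N ≤ N

/-- Every graded subspace stable under the operators `y i` is generated in bounded degrees. -/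
def StableFamiliesFG (y : ι → ∀ n, V n →ₗ[k] V (n + 1)) : Prop :=
  ∀ N, IsStableFamily y N → ∀ᶠ n in atTop, N n ≤ ⨆ i, shiftImage (y i) N n

variable {y : ι → ∀ n, V n →ₗ[k] V (n + 1)} {z : ∀ n, V n →ₗ[k] V (n + 1)}
  {N N' : ∀ n, Submodule k (V n)}

theorem shiftImage_le_iff : shiftImage z N ≤ N' ↔ ∀ n, ∀ x ∈ N n, z n x ∈ N' (n + 1) := by
  refine ⟨fun h n x hx => h (n + 1) ⟨x, hx, rfl⟩, fun h n => ?_⟩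
  cases n with
  | zero => exact bot_le
  | succ n => exact Submodule.map_le_iff_le_comap.2 (h n)

theorem isStableFamily_iff :
    IsStableFamily y N ↔ ∀ i n, ∀ x ∈ N n, y i n x ∈ N (n + 1) :=
  forall_congr' fun _ => shiftImage_le_iff

theorem IsStableFamily.shiftImage (hN : IsStableFamily y N)
    (hz : ∀ i n x, y i (n + 1) (z n x) = z (n + 1) (y i n x)) :
    IsStableFamily y (shiftImage z N) := by
  refine isStableFamily_iff.2 fun i n => ?_
  cases n with
  | zero =>
    rintro x (rfl : x = 0)
    exact (map_zero (y i 0)).symm ▸ zero_mem _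
  | succ n =>
    rintro _ ⟨x, hx, rfl⟩
    exact ⟨y i n x, isStableFamily_iff.1 hN i n x hx, (hz i n x).symm⟩

theorem IsStableFamily.sup (hN : IsStableFamily y N) (hN' : IsStableFamily y N') :
    IsStableFamily y (N ⊔ N') := by
  rw [isStableFamily_iff] at *
  refine fun i n => show N n ⊔ N' n ≤ (N (n + 1) ⊔ N' (n + 1)).comap (y i n) from
    sup_le (fun x hx => Submodule.mem_sup_left (hN i n x hx))
      fun x hx => Submodule.mem_sup_right (hN' i n x hx)

theorem IsStableFamily.inf_comap (hN : IsStableFamily y N) (hN' : IsStableFamily y N')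
    (hz : ∀ i n x, y i (n + 1) (z n x) = z (n + 1) (y i n x)) :
    IsStableFamily y fun n => N n ⊓ (N' (n + 1)).comap (z n) := by
  rw [isStableFamily_iff] at *
  rintro i n x ⟨hx, hzx⟩
  refine ⟨hN i n x hx, ?_⟩
  rw [SetLike.mem_coe, Submodule.mem_comap, ← hz]
  exact hN' i (n + 1) _ hzx

end StableFamily

variable {k ι : Type*} [DivisionRing k]

theorem finrank_map_add_finrank_inf_ker {W W' : Type*} [AddCommGroup W] [Module k W]
    [AddCommGroup W'] [Module k W'] (f : W →ₗ[k] W') (N : Submodule k W) [FiniteDimensional k N] :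
    Module.finrank k (N.map f) + Module.finrank k (N ⊓ LinearMap.ker f : Submodule k W)
      = Module.finrank k N := by
  rw [← LinearMap.finrank_range_add_finrank_ker (f.domRestrict N), LinearMap.range_domRestrict,
    LinearMap.ker_domRestrict, ← Submodule.finrank_map_subtype_eq, Submodule.map_comap_subtype]

theorem finrank_sub_finrank_inf_comap {W W' : Type*} [AddCommGroup W] [Module k W]
    [AddCommGroup W'] [Module k W'] [FiniteDimensional k W] [FiniteDimensional k W']
    (f : W →ₗ[k] W') (N : Submodule k W) (N' : Submodule k W') :
    (Module.finrank k N : ℚ) - Module.finrank k (N ⊓ N'.comap f : Submodule k W)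
      = Module.finrank k (N' ⊔ N.map f : Submodule k W') - Module.finrank k N' := by
  have hN := finrank_map_add_finrank_inf_ker (N'.mkQ ∘ₗ f) N
  have hsup := finrank_map_add_finrank_inf_ker N'.mkQ (N' ⊔ N.map f)
  rw [LinearMap.ker_comp, Submodule.ker_mkQ, Submodule.map_comp] at hN
  rw [Submodule.map_sup, Submodule.mkQ_map_self, bot_sup_eq, Submodule.ker_mkQ,
    inf_eq_right.2 le_sup_left] at hsup
  rw [← hN, ← hsup]
  push_cast
  ring

variable {V : ℕ → Type*} [∀ n, AddCommGroup (V n)] [∀ n, Module k (V n)]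
  [∀ n, FiniteDimensional k (V n)] {y : ι → ∀ n, V n →ₗ[k] V (n + 1)}

theorem eventuallyPolynomial_finrank_sub
    (hcomm : ∀ i j n x, y i (n + 1) (y j n x) = y j (n + 1) (y i n x))
    (hfg : StableFamiliesFG y) (S : Finset ι) {N N' : ∀ n, Submodule k (V n)}
    (hN : IsStableFamily y N) (hN' : IsStableFamily y N') (hle : N' ≤ N)
    (hS : ∀ i ∉ S, shiftImage (y i) N ≤ N') :
    EventuallyPolynomial fun n => Module.finrank k (N n) - Module.finrank k (N' n) := by
  classical
  induction S using Finset.induction_on generalizing N N' with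
  | empty =>
    refine eventuallyPolynomial_zero.congr ?_
    filter_upwards [hfg N hN] with n hn
    have heq : N n = N' n :=
      le_antisymm (hn.trans (iSup_le fun i => hS i (Finset.notMem_empty i) n)) (hle n)
    rw [heq, sub_self]
  | insert j S _ ih =>
    -- `y j` kills both the kernel (`hK`) and the cokernel (`hC`) of its action on `N / N'`
    have hNz := shiftImage_le_iff.1 (hN' j)
    have hK := ih (hN.inf_comap hN' fun i => hcomm i j) hN'
      (fun n x hx => ⟨hle n hx, hNz n x hx⟩) fun i hi => by
        rcases eq_or_ne i j with rfl | hij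
        · exact shiftImage_le_iff.2 fun n x hx => hx.2
        · refine shiftImage_le_iff.2 fun n x hx => ?_
          exact shiftImage_le_iff.1 (hS i (by simp [hij, hi])) n x hx.1
    have hC := ih hN (hN'.sup (hN.shiftImage fun i => hcomm i j)) (sup_le hle (hN j)) fun i hi => by
      rcases eq_or_ne i j with rfl | hij
      · exact le_sup_right
      · exact (hS i (by simp [hij, hi])).trans le_sup_left
    refine .of_sub ((hC.comp_add_one.sub hK).congr (.of_forall fun n => ?_))
    have := finrank_sub_finrank_inf_comap (y j n) (N n) (N' (n + 1))
    change (_ : ℚ) - Module.finrank k (N' (n + 1) ⊔ (N n).map (y j n) : Submodule k (V (n + 1)))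
      - (Module.finrank k (N n ⊓ (N' (n + 1)).comap (y j n) : Submodule k (V n)) - _) = _
    linarith

theorem eventuallyPolynomial_finrank [Finite ι]
    (hcomm : ∀ i j n x, y i (n + 1) (y j n x) = y j (n + 1) (y i n x))
    (hfg : StableFamiliesFG y) : EventuallyPolynomial fun n => Module.finrank k (V n) := by
  cases nonempty_fintype ι
  have h := eventuallyPolynomial_finrank_sub hcomm hfg Finset.univ (N := fun _ => ⊤)
    (N' := fun _ => ⊥) (fun _ _ => le_top) (isStableFamily_iff.2 fun i n x hx => by simp_all)
    bot_le fun i hi => absurd (Finset.mem_univ i) hi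
  simpa using h

end HilbertFunction

section SymmetricTensors

open MvPolynomial

theorem sum_mul_eq_zero_of_sum_monomial_eq_zero {R σ ι : Type*} [CommSemiring R] {s : Finset ι}
    {w : ι → σ →₀ ℕ} {a c : ι → R} (h : ∑ I ∈ s, monomial (w I) (a I) = 0)
    (hc : ∀ I I', w I = w I' → c I = c I') : ∑ I ∈ s, a I * c I = 0 := by
  obtain ⟨c', rfl⟩ := (Function.factorsThrough_iff (f := w) c).1 fun I I' => hc I I'
  have h' := congrArg ((basisMonomials σ R).constr R c') h
  have hmon : ∀ α r, (basisMonomials σ R).constr R c' (monomial α r) = r * c' α := fun α r => by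
    have hr : monomial α r = r • basisMonomials σ R α := by simp [smul_monomial]
    rw [hr, map_smul, Module.Basis.constr_basis, smul_eq_mul]
  simpa only [map_sum, hmon, map_zero] using! h'

theorem exists_perm_of_sum_single_eq {ι κ : Type*} [Fintype ι] {I I' : ι → κ}
    (h : ∑ j, Finsupp.single (I j) 1 = ∑ j, Finsupp.single (I' j) (1 : ℕ)) :
    ∃ σ : Equiv.Perm ι, I' = I ∘ σ := by
  classical
  have hcard : ∀ c, Nonempty ({j // I' j = c} ≃ {j // I j = c}) := fun c => by
    have hc := DFunLike.congr_fun h c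
    simp only [Finsupp.finsetSum_apply, Finsupp.single_apply, Finset.sum_boole, Nat.cast_id] at hc
    exact Fintype.card_eq.1 (by rw [Fintype.card_subtype, Fintype.card_subtype, hc])
  let e := fun c => (hcard c).some
  exact ⟨(Equiv.sigmaFiberEquiv I').symm.trans
    ((Equiv.sigmaCongrRight e).trans (Equiv.sigmaFiberEquiv I)),
    funext fun j => (e (I' j) ⟨j, rfl⟩).2.symm⟩

variable {k κ U : Type*} [Field k] [AddCommGroup U] [Module k U] {d : ℕ}

theorem piTensorProduct_repr_comp_perm (b : Module.Basis κ k U) (t : dividedPower k U d)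
    (σ : Equiv.Perm (Fin d)) (I : Fin d → κ) :
    (Basis.piTensorProduct fun _ => b).repr (t : ⨂[k] _ : Fin d, U) (I ∘ σ)
      = (Basis.piTensorProduct fun _ => b).repr (t : ⨂[k] _ : Fin d, U) I := by
  have ht : PiTensorProduct.reindex k (fun _ : Fin d => U) σ (t : ⨂[k] _ : Fin d, U) = t :=
    (Submodule.mem_iInf _).1 t.2 σ
  conv_rhs => rw [← ht]
  induction (t : ⨂[k] _ : Fin d, U) using PiTensorProduct.induction_on with
  | smul_tprod r f =>
    simp only [map_smul, Finsupp.smul_apply, PiTensorProduct.reindex_tprod,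
      Basis.piTensorProduct_repr_tprod_apply]
    exact congrArg (r • ·) (Fintype.prod_equiv σ _ _ fun j => by simp)
  | add x y hx hy => simp only [map_add, Finsupp.add_apply, hx, hy]

/- For a functional `f` killing every `u ⊗ ⋯ ⊗ u`, the polynomial `f (u ⊗ ⋯ ⊗ u)` in the coordinates
of `u` vanishes; on a symmetric tensor, `f` only depends on the coefficients of this polynomial. -/
theorem apply_eq_zero_of_forall_tprod_eq_zero [Infinite k] [Finite κ] (b : Module.Basis κ k U)
    {f : (⨂[k] _ : Fin d, U) →ₗ[k] k} (hf : ∀ u, f (PiTensorProduct.tprod k fun _ => u) = 0)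
    (t : dividedPower k U d) : f t = 0 := by
  classical
  have := Fintype.ofFinite κ
  let bt := Basis.piTensorProduct (R := k) fun _ : Fin d => b
  have hpoly : ∑ I, monomial (∑ j, Finsupp.single (I j) 1) (f (bt I)) = 0 := by
    refine funext fun x => ?_
    have hx := hf (∑ i, x i • b i)
    rw [MultilinearMap.map_sum, map_sum] at hx
    rw [map_zero, map_sum, ← hx]
    refine Finset.sum_congr rfl fun I _ => ?_
    rw [MultilinearMap.map_smul_univ, map_smul, monomial_sum_index, map_mul, map_prod,
      eval_C, Basis.piTensorProduct_apply, smul_eq_mul, mul_comm]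
    simp [eval_monomial]
  rw [← bt.sum_repr (t : ⨂[k] _ : Fin d, U), map_sum]
  simp only [map_smul, smul_eq_mul, mul_comm (bt.repr _ _)]
  refine sum_mul_eq_zero_of_sum_monomial_eq_zero hpoly fun I I' h => ?_
  obtain ⟨σ, rfl⟩ := exists_perm_of_sum_single_eq h
  exact (piTensorProduct_repr_comp_perm b t σ I).symm

theorem span_range_dpow [Infinite k] [FiniteDimensional k U] :
    Submodule.span k (Set.range (dpow k (U := U) d)) = ⊤ := by
  by_contra hne
  obtain ⟨f, hf, hspan⟩ := Submodule.exists_le_ker_of_lt_top _ (lt_top_iff_ne_top.2 hne)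
  obtain ⟨f', rfl⟩ := LinearMap.exists_extend f
  exact hf <| LinearMap.ext <| apply_eq_zero_of_forall_tprod_eq_zero (Module.finBasis k U)
    fun u => hspan (Submodule.subset_span ⟨u, rfl⟩)

end SymmetricTensors

section ShiftAction

variable {k D : Type*} [Field k] [AddCommGroup D] [Module k D]

theorem smul_mem_of_forall_ι_smul_mem {T : Type*} [AddCommGroup T] [Module k T]
    [Module (SymmetricAlgebra k D) T] [IsScalarTower k (SymmetricAlgebra k D) T]
    {Z : Submodule k T} (hZ : ∀ t, ∀ x ∈ Z, SymmetricAlgebra.ι k D t • x ∈ Z)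
    (f : SymmetricAlgebra k D) {x : T} (hx : x ∈ Z) : f • x ∈ Z := by
  induction f using SymmetricAlgebra.induction generalizing x with
  | algebraMap c => exact (algebraMap_smul (SymmetricAlgebra k D) c x).symm ▸ Z.smul_mem c hx
  | ι t => exact hZ t x hx
  | mul f g hf hg => exact mul_smul f g x ▸ hf (hg hx)
  | add f g hf hg => exact add_smul f g x ▸ Z.add_mem (hf hx) (hg hx)

open scoped IsMulCommutative in
theorem exists_algHom_forall_ι_eq {B : Type*} [Ring B] [Algebra k B] (a : D →ₗ[k] B)
    (ha : ∀ s t, a s * a t = a t * a s) :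
    ∃ ρ : SymmetricAlgebra k D →ₐ[k] B, ∀ t, ρ (SymmetricAlgebra.ι k D t) = a t := by
  have := Algebra.isMulCommutative_adjoin k (s := Set.range a) (by
    rintro _ ⟨s, rfl⟩ _ ⟨t, rfl⟩
    exact ha s t)
  let a' : D →ₗ[k] Algebra.adjoin k (Set.range a) :=
    a.codRestrict (Subalgebra.toSubmodule (Algebra.adjoin k (Set.range a)))
      fun t => Algebra.subset_adjoin ⟨t, rfl⟩
  exact ⟨(Algebra.adjoin k (Set.range a)).val.comp (SymmetricAlgebra.lift a'), fun t =>
    congrArg Subtype.val (SymmetricAlgebra.lift_ι_apply (f := a') (a := t))⟩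

variable {V : ℕ → Type*} [∀ n, AddCommGroup (V n)] [∀ n, Module k (V n)]

/-- The operator on `⨁ n, V n` given by maps `V n → V (n + 1)`. -/
def shiftMap (f : ∀ n, V n →ₗ[k] V (n + 1)) : Module.End k (⨁ n, V n) :=
  DirectSum.toModule k ℕ _ fun n => DirectSum.lof k ℕ V (n + 1) ∘ₗ f n

@[simp]
theorem shiftMap_lof (f : ∀ n, V n →ₗ[k] V (n + 1)) (n : ℕ) (x : V n) :
    shiftMap f (DirectSum.lof k ℕ V n x) = DirectSum.lof k ℕ V (n + 1) (f n x) :=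
  DirectSum.toModule_lof k n x

theorem shiftMap_apply_zero (f : ∀ n, V n →ₗ[k] V (n + 1)) (x : ⨁ n, V n) :
    shiftMap f x 0 = 0 := by
  suffices h : DirectSum.component k ℕ V 0 ∘ₗ shiftMap f = 0 from LinearMap.congr_fun h x
  ext n x
  simp [DirectSum.component.of]

theorem shiftMap_apply_succ (f : ∀ n, V n →ₗ[k] V (n + 1)) (x : ⨁ n, V n) (n : ℕ) :
    shiftMap f x (n + 1) = f n (x n) := by
  suffices h : DirectSum.component k ℕ V (n + 1) ∘ₗ shiftMap f
      = f n ∘ₗ DirectSum.component k ℕ V n from LinearMap.congr_fun h x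
  ext m x
  rcases eq_or_ne m n with rfl | hmn
  · simp
  · simp [DirectSum.component.of, hmn]

theorem exists_algHom_forall_ι_eq_shiftMap (act : D →ₗ[k] ∀ n, V n →ₗ[k] V (n + 1))
    (hcomm : ∀ s t n x, act s (n + 1) (act t n x) = act t (n + 1) (act s n x)) :
    ∃ ρ : SymmetricAlgebra k D →ₐ[k] Module.End k (⨁ n, V n),
      ∀ t, ρ (SymmetricAlgebra.ι k D t) = shiftMap (act t) := by
  let a : D →ₗ[k] Module.End k (⨁ n, V n) :=
    { toFun t := shiftMap (act t)
      map_add' s t := DirectSum.linearMap_ext k fun n => LinearMap.ext fun x => by simp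
      map_smul' c t := DirectSum.linearMap_ext k fun n => LinearMap.ext fun x => by simp }
  exact exists_algHom_forall_ι_eq a fun s t =>
    DirectSum.linearMap_ext k fun n => LinearMap.ext fun x => by simp [a, hcomm s t n x]

/-- A `Sym D`-module structure on `⨁ n, V n` in which the vectors of `D` act with degree one,
through the maps `act t n : V n → V (n + 1)`. -/
def IsShiftAction [Module (SymmetricAlgebra k D) (⨁ n, V n)]
    (act : D →ₗ[k] ∀ n, V n →ₗ[k] V (n + 1)) : Prop :=
  ∀ t x, SymmetricAlgebra.ι k D t • x = shiftMap (act t) x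

section Module

variable [Module (SymmetricAlgebra k D) (⨁ n, V n)]
  [IsScalarTower k (SymmetricAlgebra k D) (⨁ n, V n)]
  {act : D →ₗ[k] ∀ n, V n →ₗ[k] V (n + 1)}

theorem IsShiftAction.smul_apply_mem (hact : IsShiftAction act) {N : ∀ n, Submodule k (V n)}
    (hN : IsStableFamily act N) (f : SymmetricAlgebra k D) {x : ⨁ n, V n}
    (hx : ∀ n, x n ∈ N n) (n : ℕ) : (f • x) n ∈ N n := by
  let Z : Submodule k (⨁ n, V n) := ⨅ n, (N n).comap (DirectSum.component k ℕ V n)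
  have mem_Z : ∀ x, x ∈ Z ↔ ∀ n, x n ∈ N n := fun x => Submodule.mem_iInf _
  refine (mem_Z _).1 (smul_mem_of_forall_ι_smul_mem (fun t x hx => ?_) f ((mem_Z x).2 hx)) n
  rw [mem_Z] at hx ⊢
  rw [hact]
  intro n
  cases n with
  | zero => exact (shiftMap_apply_zero (act t) x).symm ▸ zero_mem _
  | succ n => exact shiftMap_apply_succ (act t) x n ▸ isStableFamily_iff.1 hN t n _ (hx n)

/-- The homogeneous submodule of `⨁ n, V n` whose components are a stable graded subspace. -/
def IsShiftAction.gradedSubmodule (hact : IsShiftAction act) (N : ∀ n, Submodule k (V n))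
    (hN : IsStableFamily act N) : Submodule (SymmetricAlgebra k D) (⨁ n, V n) where
  carrier := {x | ∀ n, x n ∈ N n}
  zero_mem' n := zero_mem (N n)
  add_mem' hx hy n := add_mem (hx n) (hy n)
  smul_mem' f _ hx := hact.smul_apply_mem hN f hx

theorem IsShiftAction.lof_mem_gradedSubmodule (hact : IsShiftAction act)
    {N : ∀ n, Submodule k (V n)} {hN : IsStableFamily act N} {n : ℕ} {x : V n} :
    DirectSum.lof k ℕ V n x ∈ hact.gradedSubmodule N hN ↔ x ∈ N n := by
  refine ⟨fun h => DirectSum.lof_apply k n x ▸ h n, fun hx m => ?_⟩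
  rcases eq_or_ne n m with rfl | hnm
  · exact (DirectSum.lof_apply k n x).symm ▸ hx
  · exact (DirectSum.of_eq_of_ne n m x hnm.symm : DirectSum.lof k ℕ V n x m = 0) ▸ zero_mem _

theorem IsShiftAction.stableFamiliesFG [IsNoetherian (SymmetricAlgebra k D) (⨁ n, V n)]
    (hact : IsShiftAction act) : StableFamiliesFG act := by
  intro N hN
  -- the submodule of `N` generated by its components of degree at most `m`, up to degree `m + 1`
  let W : ℕ → ∀ n, Submodule k (V n) := fun m n =>
    if n ≤ m then N n else ⨆ t, shiftImage (act t) N n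
  have W_of_le : ∀ {m n}, n ≤ m → W m n = N n := fun h => if_pos h
  have W_of_lt : ∀ {m n}, m < n → W m n = ⨆ t, shiftImage (act t) N n := fun h =>
    if_neg h.not_ge
  have hgen_le : ∀ n, ⨆ t, shiftImage (act t) N n ≤ N n := fun n => iSup_le fun t => hN t n
  have hW_le : ∀ m, W m ≤ N := fun m n =>
    (le_or_gt n m).elim (fun h => (W_of_le h).le) fun h => (W_of_lt h).trans_le (hgen_le n)
  have hle_W : ∀ m n, ⨆ t, shiftImage (act t) N n ≤ W m n := fun m n =>
    (le_or_gt n m).elim (fun h => (hgen_le n).trans (W_of_le h).ge) fun h => (W_of_lt h).ge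
  have hmono : Monotone W := fun m m' hm n => (le_or_gt n m).elim
    (fun h => (hW_le m n).trans (W_of_le (h.trans hm)).ge)
    fun h => (W_of_lt h).trans_le (hle_W m' n)
  have hW : ∀ m, IsStableFamily act (W m) := fun m => isStableFamily_iff.2 fun t n x hx =>
    hle_W m (n + 1) (Submodule.mem_iSup_of_mem t ⟨x, hW_le m n hx, rfl⟩)
  obtain ⟨m, hm⟩ := monotone_stabilizes_iff_noetherian.2 ‹_› (⟨fun m => hact.gradedSubmodule (W m)
    (hW m), fun _ _ h _ hx n => hmono h n (hx n)⟩ : ℕ →o _)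
  filter_upwards [eventually_gt_atTop m] with n hn x hx
  have hxn : DirectSum.lof k ℕ V n x ∈ hact.gradedSubmodule (W n) (hW n) :=
    hact.lof_mem_gradedSubmodule.2 ((W_of_le le_rfl).ge hx)
  have hxm : DirectSum.lof k ℕ V n x ∈ hact.gradedSubmodule (W m) (hW m) := (hm n hn.le).ge hxn
  exact (W_of_lt hn).le (hact.lof_mem_gradedSubmodule.1 hxm)

theorem IsShiftAction.finite [∀ n, FiniteDimensional k (V n)] (hact : IsShiftAction act)
    (hgen : ∀ᶠ n in atTop, ⊤ ≤ ⨆ t, shiftImage (act t) (fun _ => ⊤) n) :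
    Module.Finite (SymmetricAlgebra k D) (⨁ n, V n) := by
  obtain ⟨n₀, hn₀⟩ := eventually_atTop.1 hgen
  let M : Submodule (SymmetricAlgebra k D) (⨁ n, V n) :=
    ⨆ n : Fin n₀, Submodule.span _ (Set.range (DirectSum.lof k ℕ V n ∘ Module.finBasis k (V n)))
  have hM : ∀ n, ⊤ ≤ (M.restrictScalars k).comap (DirectSum.lof k ℕ V n) := by
    intro n
    induction n with
    | zero =>
      rcases lt_or_ge 0 n₀ with h | h
      · rw [← (Module.finBasis k (V 0)).span_eq, Submodule.span_le]
        rintro _ ⟨i, rfl⟩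
        exact Submodule.mem_iSup_of_mem (⟨0, h⟩ : Fin n₀) (Submodule.subset_span ⟨i, rfl⟩)
      · exact (hn₀ 0 h).trans (iSup_le fun _ => bot_le)
    | succ n ih =>
      rcases lt_or_ge (n + 1) n₀ with h | h
      · rw [← (Module.finBasis k (V (n + 1))).span_eq, Submodule.span_le]
        rintro _ ⟨i, rfl⟩
        exact Submodule.mem_iSup_of_mem (⟨n + 1, h⟩ : Fin n₀) (Submodule.subset_span ⟨i, rfl⟩)
      · refine (hn₀ (n + 1) h).trans (iSup_le fun t => ?_)
        rintro _ ⟨x, -, rfl⟩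
        have hx := M.smul_mem (SymmetricAlgebra.ι k D t) (ih (x := x) trivial)
        rwa [hact, shiftMap_lof] at hx
  refine ⟨(?_ : M = ⊤) ▸ Submodule.fg_iSup _ fun n => Submodule.fg_span (Set.finite_range _)⟩
  refine eq_top_iff.2 fun x _ => ?_
  induction x using DirectSum.induction_on with
  | zero => exact zero_mem M
  | of n x => exact hM n trivial
  | add x y hx hy => exact add_mem (hx trivial) (hy trivial)

end Module

theorem stableFamiliesFG_of_eventually_top_le [FiniteDimensional k D]
    [∀ n, FiniteDimensional k (V n)] {act : D →ₗ[k] ∀ n, V n →ₗ[k] V (n + 1)}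
    (hcomm : ∀ s t n x, act s (n + 1) (act t n x) = act t (n + 1) (act s n x))
    (hgen : ∀ᶠ n in atTop, ⊤ ≤ ⨆ t, shiftImage (act t) (fun _ => ⊤) n) :
    StableFamiliesFG act := by
  obtain ⟨ρ, hρ⟩ := exists_algHom_forall_ι_eq_shiftMap act hcomm
  let := Module.compHom (⨁ n, V n) ρ.toRingHom
  have : IsScalarTower k (SymmetricAlgebra k D) (⨁ n, V n) :=
    ⟨fun c f x => LinearMap.congr_fun (map_smul ρ c f) x⟩
  have hact : IsShiftAction act := fun t x => LinearMap.congr_fun (hρ t) x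
  have : IsNoetherianRing (SymmetricAlgebra k D) := isNoetherianRing_of_ringEquiv _
    (SymmetricAlgebra.equivMvPolynomial (Module.finBasis k D)).symm.toRingEquiv
  have := hact.finite hgen
  exact hact.stableFamiliesFG

theorem StableFamiliesFG.comp_basis {act : D →ₗ[k] ∀ n, V n →ₗ[k] V (n + 1)} {ι : Type*}
    (hact : StableFamiliesFG act) (b : Module.Basis ι k D) :
    StableFamiliesFG fun i => act (b i) := by
  have hmem : ∀ (N N' : ∀ n, Submodule k (V n)) n,
      (∀ i, ∀ x ∈ N n, act (b i) n x ∈ N' (n + 1)) →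
      ∀ t, ∀ x ∈ N n, act t n x ∈ N' (n + 1) := fun N N' n h t x hx => by
    let φ : D →ₗ[k] V (n + 1) := LinearMap.applyₗ x ∘ₗ LinearMap.proj n ∘ₗ act
    have htop : ⊤ ≤ (N' (n + 1)).comap φ := by
      rw [← b.span_eq, Submodule.span_le]
      rintro _ ⟨i, rfl⟩
      exact h i x hx
    exact htop (x := t) trivial
  intro N hN
  filter_upwards [hact N (isStableFamily_iff.2 fun t n =>
    hmem N N n (fun i => isStableFamily_iff.1 hN i n) t)] with n hn
  let N' : ∀ n, Submodule k (V n) := fun n => ⨆ i, shiftImage (act (b i)) N n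
  have hle : ∀ t, shiftImage (act t) N ≤ N' := fun t => shiftImage_le_iff.2 fun n =>
    hmem N N' n (fun i x hx => Submodule.mem_iSup_of_mem i ⟨x, hx, rfl⟩) t
  exact hn.trans (iSup_le fun t => hle t n)

end ShiftAction

section Subquotient

/-- `V` is a subquotient of `W` through the relation `Q`: `Q` is the graph of a surjective linear
map onto `V` from a submodule of `W`. -/
structure IsSubquotient {k W V : Type*} [Semiring k] [AddCommMonoid W] [Module k W]
    [AddCommMonoid V] [Module k V] (Q : Submodule k (W × V)) : Prop where
  eq_zero : ∀ {v}, (0, v) ∈ Q → v = 0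
  exists_mem : ∀ v, ∃ w, (w, v) ∈ Q

section Basic

variable {k W V : Type*} [Field k] [AddCommGroup W] [Module k W] [AddCommGroup V] [Module k V]
  {Q : Submodule k (W × V)}

theorem IsSubquotient.eq_of_mem (hQ : IsSubquotient Q) {w : W} {v v' : V} (h : (w, v) ∈ Q)
    (h' : (w, v') ∈ Q) : v = v' :=
  sub_eq_zero.1 (hQ.eq_zero (by simpa using Q.sub_mem h h'))

theorem IsSubquotient.fst_injective (hQ : IsSubquotient Q) :
    Function.Injective (LinearMap.fst k W V ∘ₗ Q.subtype) := by
  rintro ⟨⟨w, v⟩, h⟩ ⟨⟨w', v'⟩, h'⟩ (rfl : w = w')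
  exact Subtype.ext (Prod.ext rfl (hQ.eq_of_mem h h'))

theorem IsSubquotient.snd_surjective (hQ : IsSubquotient Q) :
    Function.Surjective (LinearMap.snd k W V ∘ₗ Q.subtype) := fun v =>
  (hQ.exists_mem v).elim fun w h => ⟨⟨(w, v), h⟩, rfl⟩

variable [FiniteDimensional k W]

theorem IsSubquotient.finiteDimensional (hQ : IsSubquotient Q) : FiniteDimensional k V :=
  have := FiniteDimensional.of_injective _ hQ.fst_injective
  Module.Finite.of_surjective _ hQ.snd_surjective

theorem IsSubquotient.finrank_le (hQ : IsSubquotient Q) :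
    Module.finrank k V ≤ Module.finrank k W :=
  have := FiniteDimensional.of_injective _ hQ.fst_injective
  (LinearMap.finrank_le_finrank_of_surjective hQ.snd_surjective).trans
    (LinearMap.finrank_le_finrank_of_injective hQ.fst_injective)

end Basic

variable {k D : Type*} [Field k] [AddCommGroup D] [Module k D] {W V : ℕ → Type*}
  [∀ n, AddCommGroup (W n)] [∀ n, Module k (W n)] [∀ n, AddCommGroup (V n)] [∀ n, Module k (V n)]
  {Q : ∀ n, Submodule k (W n × V n)}

/-- The operators `a'` of degree one on `⨁ n, V n` are induced by the operators `a` on `⨁ n, W n`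
through the relations `Q n`. -/
def Intertwines (Q : ∀ n, Submodule k (W n × V n)) (a : ∀ n, W n →ₗ[k] W (n + 1))
    (a' : ∀ n, V n →ₗ[k] V (n + 1)) : Prop :=
  ∀ n w v, (w, v) ∈ Q n → (a n w, a' n v) ∈ Q (n + 1)

variable {μ : D →ₗ[k] ∀ n, W n →ₗ[k] W (n + 1)}

theorem exists_linearMap_intertwines (hQ : ∀ n, IsSubquotient (Q n)) {U : Type*} {e : U → D}
    (he : Submodule.span k (Set.range e) = ⊤) {A : U → ∀ n, V n →ₗ[k] V (n + 1)}
    (hA : ∀ u, Intertwines Q (μ (e u)) (A u)) :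
    ∃ act : D →ₗ[k] ∀ n, V n →ₗ[k] V (n + 1),
      (∀ u, act (e u) = A u) ∧ ∀ t, Intertwines Q (μ t) (act t) := by
  let G : Submodule k (D × ∀ n, V n →ₗ[k] V (n + 1)) :=
    { carrier := {p | Intertwines Q (μ p.1) p.2}
      zero_mem' n w v _ := by simp [Prod.mk_zero_zero]
      add_mem' {p q} hp hq n w v h := by
        simpa using (Q (n + 1)).add_mem (hp n w v h) (hq n w v h)
      smul_mem' c p hp n w v h := by simpa using (Q (n + 1)).smul_mem c (hp n w v h) }
  have hG : ∀ t a a', (t, a) ∈ G → (t, a') ∈ G → a = a' := fun t a a' ha ha' =>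
    funext fun n => LinearMap.ext fun v => (hQ n).exists_mem v |>.elim fun w h =>
      (hQ (n + 1)).eq_of_mem (ha n w v h) (ha' n w v h)
  have hsurj : ∀ t, ∃ a, (t, a) ∈ G := fun t => by
    suffices h : ⊤ ≤ G.map (LinearMap.fst k D _) by
      obtain ⟨⟨_, a⟩, ha, rfl⟩ := h (x := t) trivial
      exact ⟨a, ha⟩
    rw [← he, Submodule.span_le]
    rintro _ ⟨u, rfl⟩
    exact ⟨(e u, A u), hA u, rfl⟩
  obtain ⟨act, hact⟩ := Submodule.exists_eq_graph (G := G) ⟨fun p q h => Subtype.ext <|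
    Prod.ext h <| hG _ _ _ p.2 ((congrArg (·, _) h).symm ▸ q.2), fun t =>
      (hsurj t).elim fun a ha => ⟨⟨(t, a), ha⟩, rfl⟩⟩
  have hmem : ∀ t, (t, act t) ∈ G := fun t => hact ▸ (rfl : act t = act t)
  exact ⟨act, fun u => hG _ _ _ (hmem (e u)) (hA u), hmem⟩

variable {act : D →ₗ[k] ∀ n, V n →ₗ[k] V (n + 1)}

theorem Intertwines.comm (hQ : ∀ n, IsSubquotient (Q n)) (h : ∀ t, Intertwines Q (μ t) (act t))
    (hcomm : ∀ s t n w, μ s (n + 1) (μ t n w) = μ t (n + 1) (μ s n w)) (s t : D) (n : ℕ)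
    (v : V n) : act s (n + 1) (act t n v) = act t (n + 1) (act s n v) := by
  obtain ⟨w, hw⟩ := (hQ n).exists_mem v
  have hst := h s _ _ _ (h t _ _ _ hw)
  exact (hQ (n + 1 + 1)).eq_of_mem hst (hcomm s t n w ▸ h t _ _ _ (h s _ _ _ hw))

theorem StableFamiliesFG.of_intertwines (hμ : StableFamiliesFG μ) (hQ : ∀ n, IsSubquotient (Q n))
    (h : ∀ t, Intertwines Q (μ t) (act t)) : StableFamiliesFG act := by
  intro N hN
  let pullback : (∀ n, Submodule k (V n)) → ∀ n, Submodule k (W n) := fun N n =>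
    (Q n ⊓ (N n).comap (LinearMap.snd k _ _)).map (LinearMap.fst k _ _)
  have hstable : IsStableFamily μ (pullback N) := isStableFamily_iff.2 fun t n => by
    rintro _ ⟨⟨w, v⟩, ⟨hwv, hv⟩, rfl⟩
    exact ⟨_, ⟨h t n w v hwv, isStableFamily_iff.1 hN t n v hv⟩, rfl⟩
  let N' : ∀ n, Submodule k (V n) := fun n => ⨆ t, shiftImage (act t) N n
  have hle : ∀ t, shiftImage (μ t) (pullback N) ≤ pullback N' := fun t =>
    shiftImage_le_iff.2 fun n => by
      rintro _ ⟨⟨w, v⟩, ⟨hwv, hv⟩, rfl⟩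
      exact ⟨_, ⟨h t n w v hwv, Submodule.mem_iSup_of_mem t ⟨v, hv, rfl⟩⟩, rfl⟩
  filter_upwards [hμ _ hstable] with n hn v hv
  obtain ⟨w, hw⟩ := (hQ n).exists_mem v
  obtain ⟨⟨_, v'⟩, ⟨hwv', hv'⟩, rfl⟩ := hn.trans (iSup_le fun t => hle t n) ⟨(w, v), ⟨hw, hv⟩, rfl⟩
  exact (hQ n).eq_of_mem hwv' hw ▸ hv'

theorem smul_eq_zero_of_intertwines [Module (SymmetricAlgebra k D) (⨁ n, W n)]
    [IsScalarTower k (SymmetricAlgebra k D) (⨁ n, W n)]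
    [Module (SymmetricAlgebra k D) (⨁ n, V n)] [IsScalarTower k (SymmetricAlgebra k D) (⨁ n, V n)]
    (hμ : IsShiftAction μ) (hact : IsShiftAction act) (hQ : ∀ n, IsSubquotient (Q n))
    (h : ∀ t, Intertwines Q (μ t) (act t)) {f : SymmetricAlgebra k D}
    (hf : ∀ w : ⨁ n, W n, f • w = 0) (v : ⨁ n, V n) : f • v = 0 := by
  let Z : Submodule k ((⨁ n, W n) × ⨁ n, V n) := ⨅ n, (Q n).comap
    ((DirectSum.component k ℕ W n).prodMap (DirectSum.component k ℕ V n))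
  have mem_Z : ∀ p, p ∈ Z ↔ ∀ n, (p.1 n, p.2 n) ∈ Q n := fun p => Submodule.mem_iInf _
  have hZ : ∀ t, ∀ p ∈ Z, SymmetricAlgebra.ι k D t • p ∈ Z := fun t p hp => by
    rw [mem_Z] at hp ⊢
    intro n
    rw [Prod.smul_fst, Prod.smul_snd, hμ, hact]
    cases n with
    | zero => rw [shiftMap_apply_zero, shiftMap_apply_zero]; exact zero_mem (Q 0)
    | succ n => rw [shiftMap_apply_succ, shiftMap_apply_succ]; exact h t n _ _ (hp n)
  have hlift : ∀ v, ∃ w, (w, v) ∈ Z := fun v => by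
    induction v using DirectSum.induction_on with
    | zero => exact ⟨0, zero_mem Z⟩
    | of n v =>
      obtain ⟨w, hw⟩ := (hQ n).exists_mem v
      refine ⟨DirectSum.of W n w, (mem_Z _).2 fun m => ?_⟩
      rcases eq_or_ne m n with rfl | hmn
      · rwa [DirectSum.of_eq_same, DirectSum.of_eq_same]
      · rw [DirectSum.of_eq_of_ne _ _ _ hmn, DirectSum.of_eq_of_ne _ _ _ hmn]
        exact zero_mem (Q m)
    | add v v' hv hv' =>
      obtain ⟨⟨w, hw⟩, w', hw'⟩ := And.intro hv hv'
      exact ⟨w + w', Z.add_mem hw hw'⟩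
  obtain ⟨w, hw⟩ := hlift v
  have hfw := (mem_Z _).1 (smul_mem_of_forall_ι_smul_mem hZ f hw)
  refine DFinsupp.ext fun n => (hQ n).eq_zero ?_
  simpa only [Prod.smul_mk, hf w, DirectSum.zero_apply] using hfw n

end Subquotient

section Multihomogeneous

open MvPolynomial

section CommSemiring

variable {R ι κ : Type*} [CommSemiring R]

variable (R ι κ) in
/-- The polynomial `∏ j, p j`, where the variables of the different `p j` are made disjoint. -/
def prodRename [Fintype ι] :
    MultilinearMap R (fun _ : ι => MvPolynomial κ R) (MvPolynomial (ι × κ) R) :=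
  (MultilinearMap.mkPiAlgebra R ι _).compLinearMap fun j => (rename (Prod.mk j)).toLinearMap

theorem prodRename_apply [Fintype ι] (p : ι → MvPolynomial κ R) :
    prodRename R ι κ p = ∏ j, rename (Prod.mk j) (p j) :=
  rfl

theorem prodRename_mul [Fintype ι] (p q : ι → MvPolynomial κ R) :
    prodRename R ι κ (p * q) = prodRename R ι κ p * prodRename R ι κ q := by
  simp only [prodRename_apply, Pi.mul_apply, map_mul, Finset.prod_mul_distrib]

variable [DecidableEq ι]

variable (ι κ) in
/-- The weights of the multigrading in which the variable `X (j, c)` has multidegree the `j`-th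
basis vector. -/
def blockWeight (x : ι × κ) : ι → ℕ := Pi.single x.1 1

variable (R ι κ) in
/-- The polynomials in the variables `X (j, c)` that are homogeneous of degree `n` in the variables
`X (j, ·)`, for every `j`. -/
def multiDeg (n : ℕ) : Submodule R (MvPolynomial (ι × κ) R) :=
  weightedHomogeneousSubmodule R (blockWeight ι κ) fun _ => n

theorem rename_isWeightedHomogeneous {p : MvPolynomial κ R} {n : ℕ} (hp : p.IsHomogeneous n)
    (j : ι) :
    IsWeightedHomogeneous (blockWeight ι κ) (rename (Prod.mk j) p) (Pi.single j n) := by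
  intro α hα
  obtain ⟨β, rfl, hβ⟩ := coeff_rename_ne_zero _ _ _ hα
  rw [Finsupp.weight_apply, Finsupp.sum_mapDomain_index (by simp)
    fun _ _ _ => add_smul _ _ _, ← hp hβ, Finsupp.weight_apply, Finsupp.sum, Finsupp.sum]
  simp only [blockWeight, Pi.one_apply, smul_eq_mul, mul_one, ← Pi.single_smul]
  exact (map_sum (AddMonoidHom.single (fun _ => ℕ) j) β β.support).symm

theorem prodRename_mem_multiDeg [Fintype ι] {p : ι → MvPolynomial κ R} {n : ℕ}
    (hp : ∀ j, (p j).IsHomogeneous n) : prodRename R ι κ p ∈ multiDeg R ι κ n := by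
  have h := IsWeightedHomogeneous.prod Finset.univ (fun j => rename (Prod.mk j) (p j)) _
    fun j _ => rename_isWeightedHomogeneous (hp j) j
  rwa [Finset.univ_sum_single] at h

end CommSemiring

section MultiExponent

variable (ι κ : Type*) [DecidableEq ι]

/-- The exponents of the monomials in `multiDeg k ι κ n`. -/
abbrev MultiExponent (n : ℕ) : Type _ :=
  {α : ι × κ →₀ ℕ // Finsupp.weight (blockWeight ι κ) α = fun _ => n}

variable {ι κ}

theorem weight_blockWeight [Finite ι] [Fintype κ] (α : ι × κ →₀ ℕ) (j : ι) :
    Finsupp.weight (blockWeight ι κ) α j = ∑ c, α (j, c) := by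
  have := Fintype.ofFinite ι
  rw [Finsupp.weight_apply, Finsupp.sum_fintype _ _ (by simp),
    Fintype.sum_prod_type, Finset.sum_apply, Finset.sum_eq_single j] <;>
  simp +contextual [blockWeight, eq_comm]

theorem MultiExponent.sum_eq [Finite ι] [Fintype κ] {n : ℕ} (α : MultiExponent ι κ n) (j : ι) :
    ∑ c, α.1 (j, c) = n := by
  rw [← weight_blockWeight, α.2]

theorem MultiExponent.lt [Finite ι] [Finite κ] {n : ℕ} (α : MultiExponent ι κ n) (j : ι) (c : κ) :
    α.1 (j, c) < n + 1 := by
  have := Fintype.ofFinite κ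
  exact Nat.lt_succ_of_le <| (Finset.single_le_sum (f := fun c => α.1 (j, c))
    (fun _ _ => Nat.zero_le _) (Finset.mem_univ c)).trans_eq (α.sum_eq j)

instance MultiExponent.finite [Finite ι] [Finite κ] (n : ℕ) : Finite (MultiExponent ι κ n) :=
  Finite.of_injective (fun α => fun x : ι × κ => (⟨α.1 x, α.lt x.1 x.2⟩ : Fin (n + 1)))
    fun _ _ h => Subtype.ext (Finsupp.ext fun x => congrArg Fin.val (congrFun h x))

theorem MultiExponent.restrict_injective [Finite ι] [Finite κ] (c₀ : κ) (n : ℕ) :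
    Function.Injective fun (α : MultiExponent ι κ n) (x : ι × {c // c ≠ c₀}) =>
      (⟨α.1 (x.1, x.2), α.lt _ _⟩ : Fin (n + 1)) := by
  classical
  have := Fintype.ofFinite κ
  intro α β h
  have hne : ∀ j c, c ≠ c₀ → α.1 (j, c) = β.1 (j, c) := fun j c hc =>
    congrArg Fin.val (congrFun h (j, ⟨c, hc⟩))
  refine Subtype.ext (Finsupp.ext fun ⟨j, c⟩ => ?_)
  rcases eq_or_ne c c₀ with rfl | hc
  · have hsum := (α.sum_eq j).trans (β.sum_eq j).symm
    rwa [← Finset.add_sum_erase _ _ (Finset.mem_univ c),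
      ← Finset.add_sum_erase _ _ (Finset.mem_univ c),
      Finset.sum_congr rfl fun x hx => hne j x (Finset.ne_of_mem_erase hx), add_left_inj] at hsum
  · exact hne j c hc

theorem MultiExponent.card_le [Fintype ι] [Fintype κ] (n : ℕ) :
    Nat.card (MultiExponent ι κ n) ≤ (n + 1) ^ ((Fintype.card κ - 1) * Fintype.card ι) := by
  classical
  rcases isEmpty_or_nonempty κ with _ | ⟨⟨c₀⟩⟩
  · have : Subsingleton (MultiExponent ι κ n) :=
      ⟨fun α β => Subtype.ext (Finsupp.ext fun x => isEmptyElim x.2)⟩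
    exact (Finite.card_le_one_iff_subsingleton.2 this).trans (Nat.one_le_pow _ _ n.succ_pos)
  · refine (Nat.card_le_card_of_injective _ (restrict_injective c₀ n)).trans_eq ?_
    rw [Nat.card_eq_fintype_card, Fintype.card_fun, Fintype.card_fin, Fintype.card_prod,
      Fintype.card_subtype_compl, Fintype.card_subtype_eq, mul_comm]

theorem MultiExponent.isEmpty [Finite ι] [IsEmpty κ] [Nonempty ι] {n : ℕ} (hn : n ≠ 0) :
    IsEmpty (MultiExponent ι κ n) := by
  have := Fintype.ofIsEmpty (α := κ)
  exact ⟨fun α => hn ((α.sum_eq (Classical.arbitrary ι)).symm.trans (Fintype.sum_empty _))⟩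

theorem exists_prod_X_pow_dvd_monomial {R : Type*} [CommSemiring R] [Fintype ι]
    [Fintype κ] {n N : ℕ} (hN : Fintype.card κ * N < n) (α : MultiExponent ι κ n) (r : R) :
    ∃ φ : ι → κ, (∏ j, X (j, φ j)) ^ N ∣ monomial α.1 r := by
  have hlarge : ∀ j, ∃ c, N ≤ α.1 (j, c) := fun j => by
    by_contra! hlt
    refine hN.not_ge ((α.sum_eq j).symm.trans_le ?_)
    exact (Finset.sum_le_card_nsmul _ _ N fun c _ => (hlt c).le).trans_eq (by simp)
  choose φ hφ using hlarge
  have hle : ∑ j, Finsupp.single (j, φ j) N ≤ α.1 := by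
    classical
    rintro ⟨j, c⟩
    rw [Finsupp.finsetSum_apply, Finset.sum_eq_single j (fun j' _ hj' => Finsupp.single_eq_of_ne
      fun h => hj' (congrArg Prod.fst h).symm) (by simp), Finsupp.single_apply]
    split_ifs with h
    · exact (hφ j).trans_eq (congrArg α.1 h)
    · exact Nat.zero_le _
  refine ⟨φ, ?_⟩
  simp_rw [← Finset.prod_pow, X_pow_eq_monomial, ← monomial_sum_one]
  exact monomial_dvd_monomial.2 ⟨Or.inr hle, one_dvd r⟩

end MultiExponent

section Dimension

variable (k ι κ : Type*) [Field k] [DecidableEq ι]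

/-- The basis of monomials. -/
def multiDegBasis (n : ℕ) : Module.Basis (MultiExponent ι κ n) k (multiDeg k ι κ n) :=
  Module.Basis.ofRepr ((LinearEquiv.ofEq _ _ (weightedHomogeneousSubmodule_eq_finsupp_supported k
    (blockWeight ι κ) fun _ => n)).trans (AddMonoidAlgebra.supportedEquivFinsupp _))

instance finiteDimensional_multiDeg [Finite ι] [Finite κ] (n : ℕ) :
    FiniteDimensional k (multiDeg k ι κ n) :=
  Module.Finite.of_basis (multiDegBasis k ι κ n)

theorem finrank_multiDeg_le [Fintype ι] [Fintype κ] (n : ℕ) :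
    Module.finrank k (multiDeg k ι κ n) ≤ (n + 1) ^ ((Fintype.card κ - 1) * Fintype.card ι) :=
  (Module.finrank_eq_nat_card_basis (multiDegBasis k ι κ n)).trans_le (MultiExponent.card_le n)

theorem finrank_multiDeg_eq_zero [Finite ι] [IsEmpty κ] [Nonempty ι] {n : ℕ} (hn : n ≠ 0) :
    Module.finrank k (multiDeg k ι κ n) = 0 := by
  have := MultiExponent.isEmpty (ι := ι) (κ := κ) hn
  rw [Module.finrank_eq_nat_card_basis (multiDegBasis k ι κ n), Nat.card_of_isEmpty]

end Dimension

end Multihomogeneous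

section ChowCone

open MvPolynomial

theorem weightedHomogeneousComponent_mul_of_right {R σ M : Type*} [CommSemiring R]
    [AddCancelCommMonoid M] {w : σ → M} (p : MvPolynomial σ R) {q : MvPolynomial σ R} {m m' : M}
    (hq : IsWeightedHomogeneous w q m') : weightedHomogeneousComponent w (m + m') (p * q) =
      weightedHomogeneousComponent w m p * q := by
  classical
  let _ := weightedGradedAlgebra R w
  rw [← decompose'_apply, ← decompose'_apply R w p]
  exact DirectSum.coe_decompose_mul_add_of_right_mem (weightedHomogeneousSubmodule R w) hq

variable {k κ U : Type*} [Field k] [AddCommGroup U] [Module k U] (b : Module.Basis κ k U) (d : ℕ)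

/-- A vector of `U` as a linear form in its coordinates. -/
def linearForm : U →ₗ[k] MvPolynomial κ k :=
  b.constr k X

theorem linearForm_isHomogeneous (u : U) : (linearForm b u).IsHomogeneous 1 := by
  have hrange : LinearMap.range (linearForm b) ≤ homogeneousSubmodule κ k 1 := by
    rw [linearForm, Module.Basis.constr_range, Submodule.span_le]
    rintro _ ⟨c, rfl⟩
    exact isHomogeneous_X k c
  exact hrange ⟨u, rfl⟩

/-- A vector of `D^d U`, viewed as a linear function on `Sym^d(U^*)`, pulled back along the product
map `(ℓ₁, …, ℓ_d) ↦ ℓ₁ ⋯ ℓ_d`; the variable `X (j, c)` is the `c`-th coordinate of `ℓ_j`. -/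
def prodPullback : dividedPower k U d →ₗ[k] MvPolynomial (Fin d × κ) k :=
  PiTensorProduct.lift ((prodRename k (Fin d) κ).compLinearMap fun _ => linearForm b) ∘ₗ
    (dividedPower k U d).subtype

variable {d}

theorem prodPullback_dpow (u : U) :
    prodPullback b d (dpow k d u) = prodRename k (Fin d) κ fun _ => linearForm b u :=
  PiTensorProduct.lift.tprod _

theorem prodPullback_mem_multiDeg (t : dividedPower k U d) :
    prodPullback b d t ∈ multiDeg k (Fin d) κ 1 := by
  change PiTensorProduct.lift _ (t : ⨂[k] _ : Fin d, U) ∈ _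
  induction (t : ⨂[k] _ : Fin d, U) using PiTensorProduct.induction_on with
  | smul_tprod r x =>
    rw [map_smul, PiTensorProduct.lift.tprod]
    exact Submodule.smul_mem _ _
      (prodRename_mem_multiDeg fun j => linearForm_isHomogeneous b (x j))
  | add x y hx hy =>
    rw [map_add]
    exact Submodule.add_mem _ hx hy

theorem aeval_prodPullback {K : Type*} [CommRing K] [Algebra k K] (z : Fin d × κ → K)
    (t : dividedPower k U d) : aeval z (prodPullback b d t) =
      PiTensorProduct.lift ((MultilinearMap.mkPiAlgebra k (Fin d) K).compLinearMap
        fun j => b.constr k fun c => z (j, c)) (t : ⨂[k] _ : Fin d, U) := by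
  have hlinear : ∀ (j : Fin d) u, aeval z (rename (Prod.mk j) (linearForm b u)) =
      b.constr k (fun c => z (j, c)) u := fun j u => by
    have : ((aeval z).comp (rename (Prod.mk j))).toLinearMap ∘ₗ linearForm b =
        b.constr k fun c => z (j, c) := b.ext fun c => by simp [linearForm]
    exact LinearMap.congr_fun this u
  have : (aeval z).toLinearMap ∘ₗ PiTensorProduct.lift ((prodRename k (Fin d) κ).compLinearMap
      fun _ => linearForm b) = PiTensorProduct.lift
        ((MultilinearMap.mkPiAlgebra k (Fin d) K).compLinearMap fun j =>
          b.constr k fun c => z (j, c)) :=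
    PiTensorProduct.ext <| MultilinearMap.ext fun x => by
      simp [prodRename_apply, map_prod, hlinear]
  exact LinearMap.congr_fun this (t : ⨂[k] _ : Fin d, U)

theorem aeval_prodPullback_dpow {K : Type*} [CommRing K] [Algebra k K] (z : Fin d × κ → K)
    (u : U) : aeval z (prodPullback b d (dpow k d u)) =
      ∏ j, b.constr k (fun c => z (j, c)) u := by
  rw [aeval_prodPullback]
  exact PiTensorProduct.lift.tprod _

theorem weightedHomogeneousComponent_mem_of_mem_span (n : ℕ) {p : MvPolynomial (Fin d × κ) k}
    (hp : p ∈ Ideal.span (Set.range (prodPullback b d))) :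
    weightedHomogeneousComponent (blockWeight (Fin d) κ) (fun _ => n + 1) p ∈
      LinearMap.range (prodPullback b d) * multiDeg k (Fin d) κ n := by
  obtain ⟨a, rfl⟩ := Finsupp.mem_span_range_iff_exists_finsupp.1 hp
  rw [Finsupp.sum, map_sum]
  refine Submodule.sum_mem _ fun t _ => ?_
  have h := weightedHomogeneousComponent_mul_of_right (a t) (m := fun _ => n)
    (prodPullback_mem_multiDeg b t)
  rw [smul_eq_mul]
  refine h.symm ▸ mul_comm (prodPullback b d t) _ ▸ Submodule.mul_mem_mul ⟨t, rfl⟩ ?_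
  exact weightedHomogeneousComponent_mem _ _ _

variable [Infinite k] [Finite κ]

theorem exists_forall_eq_zero_of_aeval_prodPullback_eq_zero {K : Type*} [Field K] [Algebra k K]
    {z : Fin d × κ → K} (hz : ∀ t : dividedPower k U d, aeval z (prodPullback b d t) = 0) :
    ∃ j, ∀ c, z (j, c) = 0 := by
  have := Fintype.ofFinite κ
  let ℓ : Fin d → MvPolynomial κ K := fun j => ∑ c, C (z (j, c)) * X c
  have hprod : ∏ j, ℓ j = 0 := by
    refine funext_set (fun _ => Set.range (algebraMap k K))
      (fun _ => Set.infinite_range_of_injective (algebraMap k K).injective) fun x hx => ?_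
    choose y hy using fun c => hx c trivial
    have h := hz (dpow k d (∑ c, y c • b c))
    rw [aeval_prodPullback_dpow] at h
    rw [map_prod, map_zero, ← h]
    refine Finset.prod_congr rfl fun j _ => ?_
    simp only [ℓ, map_sum, map_mul, eval_C, eval_X, map_smul, Module.Basis.constr_basis, ← hy,
      Algebra.smul_def, mul_comm]
  obtain ⟨j, -, hj⟩ := Finset.prod_eq_zero_iff.1 hprod
  classical
  refine ⟨j, fun c => ?_⟩
  simpa [ℓ, Pi.single_apply] using congrArg (eval (Pi.single c 1)) hj

theorem prod_X_mem_radical (φ : Fin d → κ) :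
    ∏ j, (X (j, φ j) : MvPolynomial (Fin d × κ) k) ∈
      (Ideal.span (Set.range (prodPullback b d))).radical := by
  rw [← vanishingIdeal_zeroLocus_eq_radical (K := AlgebraicClosure k), mem_vanishingIdeal_iff,
    zeroLocus_span]
  intro z hz
  obtain ⟨j, hj⟩ := exists_forall_eq_zero_of_aeval_prodPullback_eq_zero b fun t => hz _ ⟨t, rfl⟩
  rw [map_prod, Finset.prod_eq_zero (Finset.mem_univ j) (by rw [aeval_X, hj])]

theorem eventually_multiDeg_add_one_le : ∀ᶠ n in atTop, multiDeg k (Fin d) κ (n + 1) ≤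
    LinearMap.range (prodPullback b d) * multiDeg k (Fin d) κ n := by
  have := Fintype.ofFinite κ
  obtain ⟨N, hN⟩ := Ideal.exists_radical_pow_le_of_fg
    (Ideal.span (Set.range (prodPullback b d))) (IsNoetherian.noetherian _)
  filter_upwards [eventually_ge_atTop (Fintype.card κ * N)] with n hn p hp
  have hp_mem : p ∈ Ideal.span (Set.range (prodPullback b d)) := by
    rw [p.as_sum]
    refine Ideal.sum_mem _ fun α hα => ?_
    obtain ⟨φ, hφ⟩ := exists_prod_X_pow_dvd_monomial (Nat.lt_succ_of_le hn)
      ⟨α, hp (mem_support_iff.1 hα)⟩ (coeff α p)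
    exact Ideal.mem_of_dvd _ hφ (hN (Ideal.pow_mem_pow (prod_X_mem_radical b φ) N))
  rw [← weightedHomogeneousComponent_eq_self hp]
  exact weightedHomogeneousComponent_mem_of_mem_span b n hp_mem

end ChowCone

section ChowMul

open MvPolynomial

variable {k κ U : Type*} [Field k] [AddCommGroup U] [Module k U]

/-- The action of `D^d U` on `J` copies of the coordinate ring of `d`-tuples of linear forms,
through the product map `(ℓ₁, …, ℓ_d) ↦ ℓ₁ ⋯ ℓ_d`. -/
def chowMul (b : Module.Basis κ k U) (d : ℕ) (J : Type*) : dividedPower k U d →ₗ[k]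
    ∀ n, (J → multiDeg k (Fin d) κ n) →ₗ[k] J → multiDeg k (Fin d) κ (n + 1) :=
  LinearMap.pi fun n => LinearMap.mk₂ k
    (fun t w j => ⟨prodPullback b d t * w j, by
      rw [mul_comm]
      exact IsWeightedHomogeneous.mul (w j).2 (prodPullback_mem_multiDeg b t)⟩)
    (fun s t w => by ext; simp [add_mul]) (fun c t w => by ext; simp)
    (fun t v w => by ext; simp [mul_add]) fun c t w => by ext; simp

variable {b : Module.Basis κ k U} {d : ℕ} {J : Type*}

theorem coe_chowMul_apply (t : dividedPower k U d) (n : ℕ) (w : J → multiDeg k (Fin d) κ n)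
    (j : J) : (chowMul b d J t n w j : MvPolynomial (Fin d × κ) k) = prodPullback b d t * w j :=
  rfl

theorem chowMul_comm (s t : dividedPower k U d) (n : ℕ) (w : J → multiDeg k (Fin d) κ n) :
    chowMul b d J s (n + 1) (chowMul b d J t n w) =
      chowMul b d J t (n + 1) (chowMul b d J s n w) := by
  ext j : 2
  simp only [coe_chowMul_apply, mul_left_comm]

theorem eventually_top_le_iSup_shiftImage_chowMul [Infinite k] [Finite κ] [Finite J] :
    ∀ᶠ n in atTop, ⊤ ≤ ⨆ t, shiftImage (chowMul b d J t) (fun _ => ⊤) n := by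
  classical
  obtain ⟨n₀, h⟩ := eventually_atTop.1 (eventually_multiDeg_add_one_le b (d := d))
  filter_upwards [eventually_gt_atTop n₀] with n hn
  obtain ⟨n, rfl⟩ : ∃ m, n = m + 1 := ⟨n - 1, by omega⟩
  set N : Submodule k (J → multiDeg k (Fin d) κ (n + 1)) :=
    ⨆ t, shiftImage (chowMul b d J t) (fun _ => ⊤) (n + 1)
  have hsingle : ∀ j, multiDeg k (Fin d) κ (n + 1) ≤
      (N.comap (LinearMap.single k _ j)).map (Submodule.subtype _) := fun j => by
    refine (h n (by omega)).trans (Submodule.mul_le.2 ?_)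
    rintro _ ⟨t, rfl⟩ p hp
    refine ⟨chowMul b d Unit t n (fun _ => ⟨p, hp⟩) (), ?_, rfl⟩
    refine Submodule.mem_iSup_of_mem t ⟨Pi.single j ⟨p, hp⟩, trivial, ?_⟩
    ext j' : 2
    rw [coe_chowMul_apply]
    rcases eq_or_ne j' j with rfl | hj
    · simp [coe_chowMul_apply]
    · simp [hj]
  have := Fintype.ofFinite J
  intro w _
  rw [← Finset.univ_sum_single w]
  refine Submodule.sum_mem _ fun j _ => ?_
  obtain ⟨p, hp, hpw⟩ := hsingle j (w j).2
  exact (Subtype.ext hpw : p = w j) ▸ hp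

/-- The values at a point of the homogeneous components of the `j`-th coordinate, as the
coefficients of a polynomial. -/
def evalSeries (j : J) (z : Fin d × κ → k) :
    (⨁ n, J → multiDeg k (Fin d) κ n) →ₗ[k] Polynomial k :=
  DirectSum.toModule k ℕ _ fun n => Polynomial.monomial n ∘ₗ (aeval z).toLinearMap ∘ₗ
    (multiDeg k (Fin d) κ n).subtype ∘ₗ LinearMap.proj j

theorem coeff_evalSeries (j : J) (z : Fin d × κ → k) (w : ⨁ n, J → multiDeg k (Fin d) κ n)
    (n : ℕ) : (evalSeries j z w).coeff n = aeval z (w n j : MvPolynomial (Fin d × κ) k) := by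
  suffices h : Polynomial.lcoeff k n ∘ₗ evalSeries j z = (aeval z).toLinearMap ∘ₗ
      (multiDeg k (Fin d) κ n).subtype ∘ₗ LinearMap.proj j ∘ₗ DirectSum.component k ℕ _ n from
    LinearMap.congr_fun h w
  refine DirectSum.linearMap_ext k fun m => LinearMap.ext fun v => ?_
  rcases eq_or_ne m n with rfl | hmn
  · simp [evalSeries]
  · simp [evalSeries, DirectSum.component.of, Polynomial.coeff_monomial, hmn]

theorem eq_zero_of_evalSeries_eq_zero [Infinite k] {w : ⨁ n, J → multiDeg k (Fin d) κ n}
    (hw : ∀ j z, evalSeries j z w = 0) : w = 0 := by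
  ext n j : 3
  refine MvPolynomial.funext fun z => ?_
  have h := coeff_evalSeries j z w n
  rw [hw, Polynomial.coeff_zero] at h
  simpa [aeval_def, eval₂_id] using h.symm

theorem evalSeries_shiftMap_chowMul (j : J) (z : Fin d × κ → k) (t : dividedPower k U d)
    (w : ⨁ n, J → multiDeg k (Fin d) κ n) : evalSeries j z (shiftMap (chowMul b d J t) w) =
      Polynomial.C (prodForm (fun i => b.constr k fun c => z (i, c)) t) * Polynomial.X *
        evalSeries j z w := by
  ext n
  rw [coeff_evalSeries, mul_assoc, Polynomial.coeff_C_mul]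
  cases n with
  | zero => rw [shiftMap_apply_zero, Polynomial.coeff_X_mul_zero, mul_zero]; simp
  | succ n =>
    rw [shiftMap_apply_succ, coe_chowMul_apply, map_mul, aeval_prodPullback,
      Polynomial.coeff_X_mul, coeff_evalSeries]
    rfl

section Module

variable [Module (SymmetricAlgebra k (dividedPower k U d)) (⨁ n, J → multiDeg k (Fin d) κ n)]
  [IsScalarTower k (SymmetricAlgebra k (dividedPower k U d)) (⨁ n, J → multiDeg k (Fin d) κ n)]

theorem IsShiftAction.eval_evalSeries_smul (hact : IsShiftAction (chowMul b d J)) (j : J)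
    (z : Fin d × κ → k) (c : k) (f : SymmetricAlgebra k (dividedPower k U d))
    (w : ⨁ n, J → multiDeg k (Fin d) κ n) : (evalSeries j z (f • w)).eval c =
      SymmetricAlgebra.lift (c • prodForm fun i => b.constr k fun a => z (i, a)) f *
        (evalSeries j z w).eval c := by
  induction f using SymmetricAlgebra.induction generalizing w with
  | algebraMap r => simp [algebraMap_smul]
  | ι t =>
    simp [hact t w, evalSeries_shiftMap_chowMul, mul_comm c]
  | mul f g hf hg => rw [mul_smul, hf, hg, map_mul, mul_assoc]
  | add f g hf hg => rw [add_smul, map_add, Polynomial.eval_add, hf, hg, map_add, add_mul]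

theorem IsShiftAction.chowMul_smul_eq_zero [Infinite k] (hact : IsShiftAction (chowMul b d J))
    {f : SymmetricAlgebra k (dividedPower k U d)} (hf : f ∈ chowIdeal k U d)
    (w : ⨁ n, J → multiDeg k (Fin d) κ n) : f • w = 0 := by
  have hzero : ∀ F ∈ chowVariety k U d, SymmetricAlgebra.lift F f = 0 := by
    simpa only [chowIdeal, Submodule.mem_iInf, RingHom.mem_ker] using hf
  refine eq_zero_of_evalSeries_eq_zero fun j z => Polynomial.funext fun c => ?_
  rw [hact.eval_evalSeries_smul, hzero _ ⟨c, _, rfl⟩, zero_mul, Polynomial.eval_zero]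

end Module

end ChowMul

section StandardGraded

open MvPolynomial

theorem pow_le_of_le_degree_one {k R : Type*} [CommSemiring k] [Semiring R] [Algebra k R]
    {𝒜 : ℕ → Submodule k R} [SetLike.GradedMonoid 𝒜] {L : Submodule k R} (hL : L ≤ 𝒜 1) (n : ℕ) :
    L ^ n ≤ 𝒜 n := by
  induction n with
  | zero => exact Submodule.one_le.2 SetLike.GradedOne.one_mem
  | succ n ih =>
    rw [pow_succ, Submodule.mul_le]
    exact fun x hx y hy => SetLike.GradedMul.mul_mem (ih hx) (hL hy)

section Quotient

variable {k R κ : Type*} [CommRing k] [CommRing R] [Algebra k R] {𝒜 : ℕ → Submodule k R}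
  [GradedAlgebra 𝒜] {θ : MvPolynomial κ k →ₐ[k] R} (hX : ∀ c, θ (X c) ∈ 𝒜 1)
  (hθ : Function.Surjective θ)
include hX

theorem map_homogeneousSubmodule_le (n : ℕ) :
    (homogeneousSubmodule κ k n).map θ.toLinearMap ≤ 𝒜 n := by
  rw [← homogeneousSubmodule_one_pow, Submodule.map_pow]
  refine pow_le_of_le_degree_one ?_ n
  rw [homogeneousSubmodule_one_eq_span_X, Submodule.map_span_le]
  rintro _ ⟨c, rfl⟩
  exact hX c

include hθ

theorem map_homogeneousSubmodule_eq (n : ℕ) :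
    (homogeneousSubmodule κ k n).map θ.toLinearMap = 𝒜 n := by
  refine le_antisymm (map_homogeneousSubmodule_le hX n) fun x hx => ?_
  obtain ⟨p, rfl⟩ := hθ x
  let _ := gradedAlgebra (σ := κ) (R := k)
  let f : homogeneousSubmodule κ k →+*ᵍ 𝒜 :=
    { θ.toRingHom with map_mem := fun hp => map_homogeneousSubmodule_le hX _ ⟨_, hp, rfl⟩ }
  exact ⟨DirectSum.decompose (homogeneousSubmodule κ k) p n, SetLike.coe_mem _,
    (f.map_directSumDecompose (x := p)).trans (DirectSum.decompose_of_mem_same 𝒜 hx)⟩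

theorem graded_mul_eq_pow (a n : ℕ) : 𝒜 (a * n) = 𝒜 n ^ a := by
  simp only [← map_homogeneousSubmodule_eq hX hθ, ← Submodule.map_pow,
    ← homogeneousSubmodule_one_pow _ n, ← homogeneousSubmodule_one_pow _ (a * n), ← pow_mul,
    mul_comm]

end Quotient

section Veronese

variable {k R : Type u} [Field k] [CommRing R] [Algebra k R] (𝒜 : ℕ → Submodule k R)
  [GradedAlgebra 𝒜]

instance gradedMonoid_veroneseDeg (n : ℕ) : SetLike.GradedMonoid (veroneseDeg 𝒜 n) where
  one_mem := ⟨1, rfl⟩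
  mul_mem a b := by
    rintro _ _ ⟨y, rfl⟩ ⟨z, rfl⟩
    exact ⟨GradedMonoid.GMul.mul (A := fun m => veronesePiece 𝒜 n m) y z,
      (DirectSum.of_mul_of (A := fun m => veronesePiece 𝒜 n m) y z).symm⟩

/-- The homomorphism `R[n] → R` that is the inclusion on each graded piece. -/
def veroneseToRing (n : ℕ) : Veronese 𝒜 n →ₐ[k] R :=
  DirectSum.coeAlgHom (veronesePiece 𝒜 n)

@[simp]
theorem veroneseToRing_incl (n m : ℕ) (y : veronesePiece 𝒜 n m) :
    veroneseToRing 𝒜 n (veroneseIncl 𝒜 n m y) = y :=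
  DirectSum.coeAlgHom_of (veronesePiece 𝒜 n) m y

theorem map_veroneseToRing_veroneseDeg (n m : ℕ) :
    (veroneseDeg 𝒜 n m).map (veroneseToRing 𝒜 n).toLinearMap = 𝒜 (m * n) := by
  rw [veroneseDeg, ← LinearMap.range_comp]
  have hcomp : (veroneseToRing 𝒜 n).toLinearMap ∘ₗ veroneseIncl 𝒜 n m =
      (veronesePiece 𝒜 n m).subtype := LinearMap.ext (veroneseToRing_incl 𝒜 n m)
  rw [hcomp, Submodule.range_subtype, veronesePiece]

theorem injOn_veroneseToRing (n m : ℕ) :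
    Set.InjOn (veroneseToRing 𝒜 n) (veroneseDeg 𝒜 n m) := by
  rintro _ ⟨y, rfl⟩ _ ⟨z, rfl⟩ h
  rw [veroneseToRing_incl, veroneseToRing_incl] at h
  rw [Subtype.ext h]

theorem veroneseDeg_one (n : ℕ) : veroneseDeg 𝒜 n 1 = LinearMap.range (veroneseOne 𝒜 n) := by
  rw [veroneseOne, LinearMap.range_comp_of_range_eq_top]
  · rfl
  · rw [Submodule.range_inclusion, Submodule.comap_subtype_eq_top, veronesePiece, one_mul]

variable {𝒜}

theorem veroneseDeg_eq_range_pow {n a : ℕ} (h : 𝒜 (a * n) = 𝒜 n ^ a) :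
    veroneseDeg 𝒜 n a = LinearMap.range (veroneseOne 𝒜 n) ^ a := by
  rw [← veroneseDeg_one]
  have hle := pow_le_of_le_degree_one (𝒜 := veroneseDeg 𝒜 n) le_rfl a
  refine le_antisymm (fun x hx => ?_) hle
  have hmap : veroneseToRing 𝒜 n x ∈
      (veroneseDeg 𝒜 n 1 ^ a).map (veroneseToRing 𝒜 n).toLinearMap := by
    rw [Submodule.map_pow, map_veroneseToRing_veroneseDeg, one_mul, ← h,
      ← map_veroneseToRing_veroneseDeg 𝒜 n a]
    exact Submodule.mem_map_of_mem hx
  obtain ⟨y, hy, hyx⟩ := hmap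
  exact injOn_veroneseToRing 𝒜 n a (hle hy) hx hyx ▸ hy

end Veronese

end StandardGraded

section MultilinearlyGenerated

theorem range_pow_eq_span {k A V : Type*} [CommSemiring k] [CommSemiring A] [Algebra k A]
    [AddCommMonoid V] [Module k V] (f : V →ₗ[k] A) (a : ℕ) :
    LinearMap.range f ^ a = Submodule.span k (Set.range fun x : Fin a → V => ∏ i, f (x i)) := by
  rw [Submodule.pow_eq_span_pow_set]
  congr 1
  ext y
  rw [Set.mem_pow]
  constructor
  · rintro ⟨s, rfl⟩
    choose x hx using fun i => (s i).2
    exact ⟨x, by simp only [hx, List.prod_ofFn]⟩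
  · rintro ⟨x, rfl⟩
    exact ⟨fun i => ⟨f (x i), x i, rfl⟩, by rw [List.prod_ofFn]⟩

section General

variable {k U : Type*} {A E : ℕ → Type*} [CommSemiring k] [∀ n, AddCommMonoid (A n)]
  [∀ n, Module k (A n)] [∀ n, AddCommMonoid (E n)] [∀ n, Module k (E n)]

/-- The submodules `G n` are spanned by the values of finitely many families of `d`-linear maps on
`A n` through which the operators `μ u` on the arguments induce the operators `β u`. -/
def MultilinearlyGenerated (μ : U → ∀ n, A n →ₗ[k] A (n + 1)) (d : ℕ)
    (β : U → ∀ n, E n →ₗ[k] E (n + 1)) (G : ∀ n, Submodule k (E n)) : Prop :=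
  ∃ (J : Type) (_ : Finite J) (Ψ : J → ∀ n, MultilinearMap k (fun _ : Fin d => A n) (E n)),
    (∀ u j n x, β u n (Ψ j n x) = Ψ j (n + 1) fun i => μ u n (x i)) ∧
      ∀ n, G n = Submodule.span k (⋃ j, Set.range (Ψ j n))

variable {μ : U → ∀ n, A n →ₗ[k] A (n + 1)} {β : U → ∀ n, E n →ₗ[k] E (n + 1)}

theorem multilinearlyGenerated_range_pow {B : ℕ → Type*} [∀ n, CommSemiring (B n)]
    [∀ n, Algebra k (B n)] (f : ∀ n, A n →ₗ[k] B n) (φ : U → ∀ n, B n →ₐ[k] B (n + 1))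
    (hφ : ∀ u n x, φ u n (f n x) = f (n + 1) (μ u n x)) (a : ℕ) :
    MultilinearlyGenerated μ a (fun u n => (φ u n).toLinearMap)
      fun n => LinearMap.range (f n) ^ a := by
  refine ⟨Unit, inferInstance, fun _ n =>
    (MultilinearMap.mkPiAlgebra k (Fin a) (B n)).compLinearMap fun _ => f n,
    fun u _ n x => by simp [map_prod, hφ], fun n => ?_⟩
  rw [Set.iUnion_const]
  exact range_pow_eq_span (f n) a

theorem MultilinearlyGenerated.iSup {d : ℕ} {I : Type} [Finite I]
    {G : I → ∀ n, Submodule k (E n)} (h : ∀ i, MultilinearlyGenerated μ d β (G i)) :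
    MultilinearlyGenerated μ d β fun n => ⨆ i, G i n := by
  choose J hJ Ψ hΨ hG using h
  refine ⟨Σ i, J i, inferInstance, fun p => Ψ p.1 p.2, fun u p => hΨ p.1 u p.2, fun n => ?_⟩
  simp only [hG, Set.iUnion_sigma, Submodule.span_iUnion]

theorem MultilinearlyGenerated.map₂_mk {E' : ℕ → Type*} [∀ n, AddCommMonoid (E' n)]
    [∀ n, Module k (E' n)] {β' : U → ∀ n, E' n →ₗ[k] E' (n + 1)} {G : ∀ n, Submodule k (E n)}
    {G' : ∀ n, Submodule k (E' n)} {a a' : ℕ} (h : MultilinearlyGenerated μ a β G)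
    (h' : MultilinearlyGenerated μ a' β' G') :
    MultilinearlyGenerated μ (a + a') (fun u n => TensorProduct.map (β u n) (β' u n))
      fun n => Submodule.map₂ (TensorProduct.mk k (E n) (E' n)) (G n) (G' n) := by
  obtain ⟨J, hJ, Ψ, hΨ, hG⟩ := h
  obtain ⟨J', hJ', Ψ', hΨ', hG'⟩ := h'
  let Φ : J × J' → ∀ n, MultilinearMap k (fun _ : Fin (a + a') => A n) (E n ⊗[k] E' n) :=
    fun p n => ((Ψ p.1 n).domCoprod (Ψ' p.2 n)).domDomCongr finSumFinEquiv
  have hΦ : ∀ p n x, Φ p n x = Ψ p.1 n (fun i => x (finSumFinEquiv (Sum.inl i)))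
      ⊗ₜ[k] Ψ' p.2 n (fun i => x (finSumFinEquiv (Sum.inr i))) := fun _ _ _ => rfl
  refine ⟨J × J', inferInstance, Φ, fun u p n x => ?_, fun n => ?_⟩
  · rw [hΦ, hΦ, TensorProduct.map_tmul, hΨ, hΨ']
  beta_reduce
  rw [hG, hG', Submodule.map₂_span_span]
  congr 1
  ext z
  simp only [Set.mem_image2, Set.mem_iUnion, Set.mem_range]
  constructor
  · rintro ⟨_, ⟨j, x, rfl⟩, _, ⟨j', x', rfl⟩, rfl⟩
    exact ⟨(j, j'), fun i => Sum.elim x x' (finSumFinEquiv.symm i), by simp [hΦ]⟩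
  · rintro ⟨p, x, rfl⟩
    exact ⟨_, ⟨p.1, _, rfl⟩, _, ⟨p.2, _, rfl⟩, (hΦ p n x).symm⟩

end General

variable {k R : Type u} {U : Type*} [Field k] [CommRing R] [Algebra k R] {𝒜 : ℕ → Submodule k R}
  [GradedAlgebra 𝒜] (g : U → 𝒜 1)

theorem multilinearlyGenerated_symDeg (a : ℕ) :
    MultilinearlyGenerated (fun u => degMul 𝒜 (g u)) a
      (fun u n => (symMap (degMul 𝒜 (g u) n)).toLinearMap) fun n => symDeg k (𝒜 n) a :=
  multilinearlyGenerated_range_pow (fun n => SymmetricAlgebra.ι k (𝒜 n))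
    (fun u n => symMap (degMul 𝒜 (g u) n)) (fun _ _ _ => SymmetricAlgebra.lift_ι_apply _ _) a

variable (hpow : ∀ a n, 𝒜 (a * n) = 𝒜 n ^ a)
include hpow

theorem multilinearlyGenerated_veroneseDeg (a : ℕ) :
    MultilinearlyGenerated (fun u => degMul 𝒜 (g u)) a
      (fun u n => (veroneseMul 𝒜 (g u) n).toLinearMap) fun n => veroneseDeg 𝒜 n a := by
  simp only [veroneseDeg_eq_range_pow (hpow a _)]
  refine multilinearlyGenerated_range_pow (fun n => veroneseOne 𝒜 n) _ (fun u n x => ?_) a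
  simpa [symToVeronese, symMap] using
    AlgHom.congr_fun (veroneseMul_symToVeronese 𝒜 (g u) n) (SymmetricAlgebra.ι k _ x)

theorem multilinearlyGenerated_bar (p d : ℕ) :
    MultilinearlyGenerated (fun u => degMul 𝒜 (g u)) d
      (fun u n => barMap (symDeg k (𝒜 n)) (veroneseDeg 𝒜 n) (symDeg k (𝒜 (n + 1)))
        (veroneseDeg 𝒜 (n + 1)) (symMap (degMul 𝒜 (g u) n))
        (veroneseMul 𝒜 (g u) n).toLinearMap p)
      fun n => (bar (symDeg k (𝒜 n)) (veroneseDeg 𝒜 n) p).deg d := by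
  induction p generalizing d with
  | zero => exact multilinearlyGenerated_veroneseDeg g hpow d
  | succ p ih =>
    have hdeg : ∀ n, (bar (symDeg k (𝒜 n)) (veroneseDeg 𝒜 n) (p + 1)).deg d =
        ⨆ q : Finset.HasAntidiagonal.antidiagonal d, Submodule.map₂ (TensorProduct.mk k _ _)
          (symDeg k (𝒜 n) q.1.1) ((bar (symDeg k (𝒜 n)) (veroneseDeg 𝒜 n) p).deg q.1.2) :=
      fun n => by
        rw [iSup_subtype, iSup_prod]
        simp only [Finset.HasAntidiagonal.mem_antidiagonal]
        rfl
    simp only [hdeg]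
    refine MultilinearlyGenerated.iSup fun q => ?_
    have h := (multilinearlyGenerated_symDeg g q.1.1).map₂_mk (ih q.1.2)
    rwa [Finset.HasAntidiagonal.mem_antidiagonal.1 q.2] at h

end MultilinearlyGenerated

section ProdRenameLift

open MvPolynomial

variable {k ι κ E : Type*} [CommSemiring k] [Fintype ι] [AddCommMonoid E] [Module k E]

theorem prodRename_monomial_curry (α : ι × κ →₀ ℕ) :
    prodRename k ι κ (fun j => monomial (α.curry j) 1) = monomial α 1 := by
  have hsum : ∑ j, (α.curry j).mapDomain (Prod.mk j) = α := by
    ext ⟨j, c⟩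
    rw [Finsupp.finsetSum_apply, Finset.sum_eq_single j _ (by simp),
      Finsupp.mapDomain_apply (Prod.mk_right_injective j), Finsupp.curry_apply]
    intro j' _ hj
    exact Finsupp.mapDomain_of_notMem_range _ _ fun ⟨_, h⟩ => hj (congrArg Prod.fst h)
  simp only [prodRename_apply, rename_monomial]
  rw [← monomial_sum_one, hsum]

/-- The linear map through which a multilinear map `Φ` factors over `prodRename`; it exists since
`k[X (j, c)]` is the tensor product over `j` of the polynomial rings in the `X (j, c)`. -/
def prodRenameLift (Φ : MultilinearMap k (fun _ : ι => MvPolynomial κ k) E) :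
    MvPolynomial (ι × κ) k →ₗ[k] E :=
  (basisMonomials (ι × κ) k).constr k fun α => Φ fun j => monomial (α.curry j) 1

theorem prodRenameLift_prodRename (Φ : MultilinearMap k (fun _ : ι => MvPolynomial κ k) E)
    (p : ι → MvPolynomial κ k) : prodRenameLift Φ (prodRename k ι κ p) = Φ p := by
  suffices h : (prodRenameLift Φ).compMultilinearMap (prodRename k ι κ) = Φ from
    congrArg (fun Ψ => Ψ p) h
  refine Module.Basis.ext_multilinear (fun _ => basisMonomials κ k) fun β => ?_
  obtain ⟨α, hα⟩ : ∃ α : ι × κ →₀ ℕ, ∀ j, α.curry j = β j :=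
    ⟨(Finsupp.equivFunOnFinite.symm β).uncurry, fun j => by simp⟩
  simp only [LinearMap.compMultilinearMap_apply, coe_basisMonomials, ← hα]
  rw [prodRename_monomial_curry, prodRenameLift, ← congrFun (coe_basisMonomials (ι × κ) k) α,
    Module.Basis.constr_basis]

theorem linearMap_ext_prodRename {f f' : MvPolynomial (ι × κ) k →ₗ[k] E}
    (h : ∀ p, f (prodRename k ι κ p) = f' (prodRename k ι κ p)) : f = f' :=
  (basisMonomials (ι × κ) k).ext fun α => by
    simpa [prodRename_monomial_curry] using h fun j => monomial (α.curry j) 1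

theorem prodRenameLift_prodRename_mul {E' : Type*} [AddCommMonoid E'] [Module k E']
    {Φ : MultilinearMap k (fun _ : ι => MvPolynomial κ k) E}
    {Φ' : MultilinearMap k (fun _ : ι => MvPolynomial κ k) E'} {f : E →ₗ[k] E'}
    {q : ι → MvPolynomial κ k} (h : ∀ p, Φ' (q * p) = f (Φ p)) (w : MvPolynomial (ι × κ) k) :
    prodRenameLift Φ' (prodRename k ι κ q * w) = f (prodRenameLift Φ w) := by
  suffices H : prodRenameLift Φ' ∘ₗ LinearMap.mulLeft k (prodRename k ι κ q) =
    f ∘ₗ prodRenameLift Φ from LinearMap.congr_fun H w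
  refine linearMap_ext_prodRename fun p => ?_
  simp [← prodRename_mul, prodRenameLift_prodRename, ← h]

end ProdRenameLift

section Presentation

open MvPolynomial

section General

variable {k U κ : Type*} [Field k] [AddCommGroup U] [Module k U] {A E : ℕ → Type*}
  [∀ n, AddCommGroup (A n)] [∀ n, Module k (A n)] [∀ n, AddCommGroup (E n)] [∀ n, Module k (E n)]
  {μ : U → ∀ n, A n →ₗ[k] A (n + 1)} {β : U → ∀ n, E n →ₗ[k] E (n + 1)}
  {G : ∀ n, Submodule k (E n)}

theorem MultilinearlyGenerated.exists_linearMap {d : ℕ} (h : MultilinearlyGenerated μ d β G)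
    (b : Module.Basis κ k U) {r : ∀ n, MvPolynomial κ k →ₗ[k] A n}
    (hr : ∀ u n p, r (n + 1) (linearForm b u * p) = μ u n (r n p))
    (hsurj : ∀ n x, ∃ p, p.IsHomogeneous n ∧ r n p = x) :
    ∃ (J : Type) (_ : Finite J) (F : ∀ n, (J → multiDeg k (Fin d) κ n) →ₗ[k] E n),
      (∀ u n w, F (n + 1) (chowMul b d J (dpow k d u) n w) = β u n (F n w)) ∧
        ∀ n, G n ≤ LinearMap.range (F n) := by
  classical
  obtain ⟨J, hJ, Ψ, hΨ, hG⟩ := h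
  have := Fintype.ofFinite J
  let L : ∀ n, J → MvPolynomial (Fin d × κ) k →ₗ[k] E n := fun n j =>
    prodRenameLift ((Ψ j n).compLinearMap fun _ => r n)
  let F : ∀ n, (J → multiDeg k (Fin d) κ n) →ₗ[k] E n := fun n =>
    LinearMap.lsum k _ k fun j => L n j ∘ₗ (multiDeg k (Fin d) κ n).subtype
  refine ⟨J, hJ, F, fun u n w => ?_, fun n => ?_⟩
  · have hL : ∀ j (p : MvPolynomial (Fin d × κ) k),
        L (n + 1) j (prodPullback b d (dpow k d u) * p) = β u n (L n j p) := fun j p => by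
      rw [prodPullback_dpow]
      refine prodRenameLift_prodRename_mul (fun p => ?_) p
      simp [hΨ, hr]
    simp [F, coe_chowMul_apply, hL]
  · rw [hG, Submodule.span_le]
    refine Set.iUnion_subset fun j => Set.range_subset_iff.2 fun x => ?_
    choose p hp hpx using fun i => hsurj n (x i)
    refine ⟨Pi.single j ⟨prodRename k (Fin d) κ p, prodRename_mem_multiDeg hp⟩, ?_⟩
    refine (LinearMap.lsum_piSingle ..).trans ?_
    simp [L, prodRenameLift_prodRename, hpx]

theorem isSubquotient_range_prod {W E V : Type*} [AddCommGroup W] [Module k W] [AddCommGroup E]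
    [Module k E] [AddCommGroup V] [Module k V] {F : W →ₗ[k] E} {C : Submodule k E}
    (hF : C ≤ LinearMap.range F) {q : C →ₗ[k] V} (hq : Function.Surjective q) :
    IsSubquotient (LinearMap.range ((C.comap F).subtype.prod (q ∘ₗ F.restrict fun _ h => h))) where
  eq_zero := by
    rintro v ⟨⟨w, hw⟩, h⟩
    obtain rfl : w = 0 := congrArg Prod.fst h
    exact (congrArg Prod.snd h).symm.trans (map_zero (q ∘ₗ F.restrict fun _ h => h))
  exists_mem v := by
    obtain ⟨c, rfl⟩ := hq v
    obtain ⟨w, hw⟩ := hF c.2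
    have hwC : F w ∈ C := hw ▸ c.2
    exact ⟨w, ⟨w, hwC⟩, Prod.ext rfl (congrArg q (Subtype.ext hw))⟩

end General

theorem equivMvPolynomial_symm_linearForm {k U κ : Type*} [Field k] [AddCommGroup U] [Module k U]
    (b : Module.Basis κ k U) (u : U) :
    (SymmetricAlgebra.equivMvPolynomial b).symm (linearForm b u) = SymmetricAlgebra.ι k U u := by
  suffices h : (SymmetricAlgebra.equivMvPolynomial b).symm.toLinearMap ∘ₗ linearForm b =
    SymmetricAlgebra.ι k U from LinearMap.congr_fun h u
  exact b.ext fun c => by simp [linearForm]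

theorem torCycles_le_deg {k : Type u} {S M : Type v} [Field k] [CommRing S] [Algebra k S]
    [AddCommGroup M] [Module k M] [Module S M] [IsScalarTower k S M] (ε : S →ₐ[k] k)
    (𝒮 : ℕ → Submodule k S) (ℳ : ℕ → Submodule k M) (p d : ℕ) :
    torCycles ε 𝒮 ℳ p d ≤ (bar 𝒮 ℳ p).deg d := by
  cases p with
  | zero => exact le_rfl
  | succ p => exact inf_le_left

section StandardGraded

variable {k R : Type u} {U : Type v} {κ : Type*} [Field k] [AddCommGroup U] [Module k U]
  [CommRing R] [Algebra k R] {𝒜 : ℕ → Submodule k R} [GradedAlgebra 𝒜] {g : U → 𝒜 1}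
  {b : Module.Basis κ k U} {θ : MvPolynomial κ k →ₐ[k] R}

variable (𝒜 θ) in
/-- The degree `n` component of a homomorphism from a polynomial ring to a graded ring. -/
def gradedComponent (n : ℕ) : MvPolynomial κ k →ₗ[k] 𝒜 n :=
  DirectSum.component k ℕ (fun n => 𝒜 n) n ∘ₗ
    (DirectSum.decomposeLinearEquiv 𝒜).toLinearMap ∘ₗ θ.toLinearMap

theorem coe_gradedComponent_apply (n : ℕ) (p : MvPolynomial κ k) :
    (gradedComponent 𝒜 θ n p : R) = DirectSum.decompose 𝒜 (θ p) n :=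
  rfl

theorem gradedComponent_linearForm_mul (hg : ∀ u, θ (linearForm b u) = g u) (u : U) (n : ℕ)
    (p : MvPolynomial κ k) :
    gradedComponent 𝒜 θ (n + 1) (linearForm b u * p) =
      degMul 𝒜 (g u) n (gradedComponent 𝒜 θ n p) := by
  refine Subtype.ext ?_
  rw [coe_gradedComponent_apply, map_mul, hg]
  exact (congrArg (fun m => (DirectSum.decompose 𝒜 (g u * θ p) m : R)) (add_comm n 1)).trans
    (DirectSum.coe_decompose_mul_add_of_left_mem 𝒜 (g u).2)

theorem exists_isHomogeneous_gradedComponent_eq (hX : ∀ c, θ (X c) ∈ 𝒜 1)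
    (hθ : Function.Surjective θ) (n : ℕ) (x : 𝒜 n) :
    ∃ p : MvPolynomial κ k, p.IsHomogeneous n ∧ gradedComponent 𝒜 θ n p = x := by
  obtain ⟨p, hp, hpx⟩ := (map_homogeneousSubmodule_eq hX hθ n).ge x.2
  refine ⟨p, hp, Subtype.ext ?_⟩
  rw [coe_gradedComponent_apply, show θ p = x from hpx, DirectSum.decompose_coe]
  simp

theorem exists_isSubquotient_veroneseTor (hθ : Function.Surjective θ)
    (hg : ∀ u, θ (linearForm b u) = g u) (i d : ℕ) :
    ∃ (J : Type) (_ : Finite J)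
      (Q : ∀ n, Submodule k ((J → multiDeg k (Fin d) κ n) × VeroneseTor 𝒜 i d n)),
      (∀ n, IsSubquotient (Q n)) ∧
        ∀ u, Intertwines Q (chowMul b d J (dpow k d u)) (veroneseTorMap 𝒜 (g u) i d) := by
  have hX : ∀ c, θ (X c) ∈ 𝒜 1 := fun c => by
    have h := hg (b c)
    rw [linearForm, Module.Basis.constr_basis] at h
    exact h ▸ (g (b c)).2
  obtain ⟨J, hJ, F, hF, hrange⟩ :=
    (multilinearlyGenerated_bar g (graded_mul_eq_pow hX hθ) i d).exists_linearMap b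
      (gradedComponent_linearForm_mul hg) (exists_isHomogeneous_gradedComponent_eq hX hθ)
  let C : ∀ n, Submodule k (bar (symDeg k (𝒜 n)) (veroneseDeg 𝒜 n) i).carrier := fun n =>
    torCycles SymmetricAlgebra.algebraMapInv (symDeg k (𝒜 n)) (veroneseDeg 𝒜 n) i d
  let q : ∀ n, C n →ₗ[k] VeroneseTor 𝒜 i d n := fun n => Submodule.mkQ _
  refine ⟨J, hJ, fun n => LinearMap.range
      (((C n).comap (F n)).subtype.prod (q n ∘ₗ (F n).restrict fun _ h => h)), fun n =>
    isSubquotient_range_prod ((torCycles_le_deg _ _ _ i d).trans (hrange n))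
      (Submodule.mkQ_surjective _), ?_⟩
  rintro u n _ _ ⟨⟨w, hw⟩, ⟨⟩⟩
  obtain ⟨c', hc', hqc'⟩ : ∃ c' : C (n + 1),
      (c' : (bar (symDeg k (𝒜 (n + 1))) (veroneseDeg 𝒜 (n + 1)) i).carrier) =
        F (n + 1) (chowMul b d J (dpow k d u) n w) ∧
      q (n + 1) c' = veroneseTorMap 𝒜 (g u) i d n (q n ⟨F n w, hw⟩) :=
    ⟨_, (hF u n w).symm, rfl⟩
  have hmem : F (n + 1) (chowMul b d J (dpow k d u) n w) ∈ C (n + 1) := hc' ▸ c'.2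
  exact ⟨⟨_, hmem⟩, Prod.ext rfl ((congrArg (q (n + 1)) (Subtype.ext hc'.symm)).trans hqc')⟩

end StandardGraded

end Presentation

section ChowSubquotient

variable {k U κ J : Type*} [Field k] [AddCommGroup U] [Module k U] {b : Module.Basis κ k U} {d : ℕ}
  {V : ℕ → Type*} [∀ n, AddCommGroup (V n)] [∀ n, Module k (V n)]
  {Q : ∀ n, Submodule k ((J → multiDeg k (Fin d) κ n) × V n)}
  {act : dividedPower k U d →ₗ[k] ∀ n, V n →ₗ[k] V (n + 1)}

theorem natDegree_le_of_eventually_le_finrank_multiDeg (k : Type*) [Field k] {ι κ : Type*}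
    [Fintype ι] [DecidableEq ι] [Fintype κ] {P : Polynomial ℚ} {c : ℕ}
    (hP : ∀ᶠ n : ℕ in atTop, 0 ≤ P.eval (n : ℚ) ∧
      P.eval (n : ℚ) ≤ c * Module.finrank k (multiDeg k ι κ n)) :
    P = 0 ∨ (P.natDegree : ℤ) ≤ ((Fintype.card κ : ℤ) - 1) * Fintype.card ι := by
  have hdeg : P.natDegree ≤ (Fintype.card κ - 1) * Fintype.card ι :=
    natDegree_le_of_eventually_eval_le <| hP.mono fun n h => ⟨h.1, h.2.trans <|
      mul_le_mul_of_nonneg_left (mod_cast finrank_multiDeg_le k ι κ n) c.cast_nonneg⟩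
  rcases isEmpty_or_nonempty ι with hι | hι
  · right
    simpa using hdeg
  rcases isEmpty_or_nonempty κ with hκ | hκ
  · left
    refine eq_zero_of_eventually_eval_eq_zero ?_
    filter_upwards [hP, eventually_ne_atTop 0] with n h hn
    rw [finrank_multiDeg_eq_zero k ι κ hn, Nat.cast_zero, mul_zero] at h
    exact le_antisymm h.2 h.1
  · right
    rw [← Nat.cast_pred Fintype.card_pos]
    exact_mod_cast hdeg

variable [Infinite k] [FiniteDimensional k U] [Finite κ] [Finite J]

theorem stableFamiliesFG_of_intertwines_chowMul (hQ : ∀ n, IsSubquotient (Q n))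
    (h : ∀ t, Intertwines Q (chowMul b d J t) (act t)) : StableFamiliesFG act := by
  have hchow : StableFamiliesFG (chowMul b d J) :=
    stableFamiliesFG_of_eventually_top_le (fun s t n w => chowMul_comm s t n w)
      eventually_top_le_iSup_shiftImage_chowMul
  exact hchow.of_intertwines hQ h

theorem exists_polynomial_finrank_of_intertwines_chowMul (hQ : ∀ n, IsSubquotient (Q n))
    (h : ∀ t, Intertwines Q (chowMul b d J t) (act t)) :
    ∃ P : Polynomial ℚ,
      (P = 0 ∨ (P.natDegree : ℤ) ≤ ((Module.finrank k U : ℤ) - 1) * d) ∧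
      ∀ᶠ n : ℕ in atTop, (Module.finrank k (V n) : ℚ) = P.eval (n : ℚ) := by
  have := Fintype.ofFinite J
  have := Fintype.ofFinite κ
  have := fun n => (hQ n).finiteDimensional
  obtain ⟨P, hP⟩ := eventuallyPolynomial_finrank
    (fun _ _ => Intertwines.comm hQ h chowMul_comm _ _)
    ((stableFamiliesFG_of_intertwines_chowMul hQ h).comp_basis (Module.finBasis k _))
  refine ⟨P, ?_, hP⟩
  rw [Module.finrank_eq_card_basis b, ← Fintype.card_fin d]
  refine natDegree_le_of_eventually_le_finrank_multiDeg k (c := Fintype.card J) ?_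
  filter_upwards [hP] with n hn
  have hle : Module.finrank k (V n) ≤ _ := (hQ n).finrank_le
  rw [Module.finrank_pi_fintype, Finset.sum_const, Finset.card_univ, smul_eq_mul] at hle
  rw [← hn]
  exact ⟨Nat.cast_nonneg _, mod_cast hle⟩

section Module

variable [Module (SymmetricAlgebra k (dividedPower k U d)) (⨁ n, V n)]
  [IsScalarTower k (SymmetricAlgebra k (dividedPower k U d)) (⨁ n, V n)]

theorem IsShiftAction.finite_of_intertwines_chowMul (hact : IsShiftAction act)
    (hQ : ∀ n, IsSubquotient (Q n)) (h : ∀ t, Intertwines Q (chowMul b d J t) (act t)) :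
    Module.Finite (SymmetricAlgebra k (dividedPower k U d)) (⨁ n, V n) :=
  have := fun n => (hQ n).finiteDimensional
  hact.finite (stableFamiliesFG_of_intertwines_chowMul hQ h (fun _ => ⊤) fun _ => le_top)

theorem IsShiftAction.support_subset_zeroLocus_chowIdeal (hact : IsShiftAction act)
    (hQ : ∀ n, IsSubquotient (Q n)) (h : ∀ t, Intertwines Q (chowMul b d J t) (act t)) :
    Module.support (SymmetricAlgebra k (dividedPower k U d)) (⨁ n, V n) ⊆
      PrimeSpectrum.zeroLocus (chowIdeal k U d) := by
  obtain ⟨ρ, hρ⟩ := exists_algHom_forall_ι_eq_shiftMap (chowMul b d J) chowMul_comm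
  let := Module.compHom (⨁ n, J → multiDeg k (Fin d) κ n) ρ.toRingHom
  have : IsScalarTower k (SymmetricAlgebra k (dividedPower k U d))
      (⨁ n, J → multiDeg k (Fin d) κ n) :=
    IsScalarTower.of_algebraMap_smul fun c x => LinearMap.congr_fun (ρ.commutes c) x
  have hchow : IsShiftAction (chowMul b d J) := fun t x => LinearMap.congr_fun (hρ t) x
  have hfin := hact.finite_of_intertwines_chowMul hQ h
  rw [Module.support_eq_zeroLocus]
  exact PrimeSpectrum.zeroLocus_anti_mono_ideal fun f hf => Module.mem_annihilator.2
    (smul_eq_zero_of_intertwines hchow hact hQ h (hchow.chowMul_smul_eq_zero hf))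

end Module

end ChowSubquotient

section MultiplicationAction

theorem algHom_ext_dpow {k U B : Type*} [Field k] [Infinite k] [AddCommGroup U] [Module k U]
    [FiniteDimensional k U] [Semiring B] [Algebra k B] {d : ℕ}
    {ρ ρ' : SymmetricAlgebra k (dividedPower k U d) →ₐ[k] B}
    (h : ∀ u, ρ (SymmetricAlgebra.ι k _ (dpow k d u)) = ρ' (SymmetricAlgebra.ι k _ (dpow k d u))) :
    ρ = ρ' := by
  have hι : ρ.toLinearMap ∘ₗ SymmetricAlgebra.ι k (dividedPower k U d) =
      ρ'.toLinearMap ∘ₗ SymmetricAlgebra.ι k (dividedPower k U d) :=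
    LinearMap.ext_on_range span_range_dpow h
  refine AlgHom.ext fun f => ?_
  induction f using SymmetricAlgebra.induction with
  | algebraMap c => rw [ρ.commutes, ρ'.commutes]
  | ι t => exact LinearMap.congr_fun hι t
  | mul f₁ f₂ h₁ h₂ => rw [map_mul, map_mul, h₁, h₂]
  | add f₁ f₂ h₁ h₂ => rw [map_add, map_add, h₁, h₂]

variable {k R : Type u} {U : Type v} [Field k] [AddCommGroup U] [Module k U] [CommRing R]
  [Algebra k R] {𝒜 : ℕ → Submodule k R} [GradedAlgebra 𝒜] {g : U →ₗ[k] 𝒜 1} {i d : ℕ}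

theorem isMultiplicationAction_iff
    {ρ : SymmetricAlgebra k (dividedPower k U d) →ₐ[k] Module.End k (VeroneseTorSum 𝒜 i d)} :
    IsMultiplicationAction 𝒜 g i d ρ ↔ ∀ u, ρ (SymmetricAlgebra.ι k _ (dpow k d u)) =
      shiftMap (veroneseTorMap 𝒜 (g u) i d) := by
  refine forall_congr' fun u => ⟨fun h => DirectSum.linearMap_ext k fun n => LinearMap.ext ?_, ?_⟩
  · intro x
    simpa using h n x
  · intro h n x
    rw [h, shiftMap_lof]

theorem exists_intertwines_chowMul_veroneseTor (𝒜 : ℕ → Submodule k R) [GradedAlgebra 𝒜]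
    [Infinite k] [FiniteDimensional k U] {κ : Type*}
    {π : SymmetricAlgebra k U →ₐ[k] R} (hπ : Function.Surjective π) {g : U → 𝒜 1}
    (hg : ∀ u, π (SymmetricAlgebra.ι k U u) = g u) (b : Module.Basis κ k U) (i d : ℕ) :
    ∃ act : dividedPower k U d →ₗ[k] ∀ n, VeroneseTor 𝒜 i d n →ₗ[k] VeroneseTor 𝒜 i d (n + 1),
      (∀ u, act (dpow k d u) = veroneseTorMap 𝒜 (g u) i d) ∧
      ∃ (J : Type) (_ : Finite J)
        (Q : ∀ n, Submodule k ((J → multiDeg k (Fin d) κ n) × VeroneseTor 𝒜 i d n)),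
        (∀ n, IsSubquotient (Q n)) ∧ ∀ t, Intertwines Q (chowMul b d J t) (act t) := by
  let θ := π.comp (SymmetricAlgebra.equivMvPolynomial b).symm.toAlgHom
  have hθ : Function.Surjective θ := hπ.comp (SymmetricAlgebra.equivMvPolynomial b).symm.surjective
  have hg' : ∀ u, θ (linearForm b u) = g u := fun u =>
    (congrArg π (equivMvPolynomial_symm_linearForm b u)).trans (hg u)
  have hsub := exists_isSubquotient_veroneseTor hθ hg' i d
  obtain ⟨J, hJ, Q, hQ, hmul⟩ := hsub
  have hlin := exists_linearMap_intertwines hQ span_range_dpow hmul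
  obtain ⟨act, hact, h⟩ := hlin
  exact ⟨act, hact, J, hJ, Q, hQ, h⟩

end MultiplicationAction

theorem mainTheorem1_general {k R : Type u} {U : Type v} [Field k] [Infinite k]
    [AddCommGroup U] [Module k U] [FiniteDimensional k U]
    [CommRing R] [Algebra k R] (𝒜 : ℕ → Submodule k R) [GradedAlgebra 𝒜]
    (π : SymmetricAlgebra k U →ₐ[k] R) (hπ : Function.Surjective π)
    (g : U →ₗ[k] 𝒜 1) (hg : ∀ u, π (SymmetricAlgebra.ι k U u) = g u) (i d : ℕ) :
    (∃! ρ : SymmetricAlgebra k (dividedPower k U d) →ₐ[k] Module.End k (VeroneseTorSum 𝒜 i d),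
      IsMultiplicationAction 𝒜 g i d ρ) ∧
    (∀ ρ : SymmetricAlgebra k (dividedPower k U d) →ₐ[k] Module.End k (VeroneseTorSum 𝒜 i d),
      IsMultiplicationAction 𝒜 g i d ρ →
      letI : Module (SymmetricAlgebra k (dividedPower k U d)) (VeroneseTorSum 𝒜 i d) :=
        Module.compHom _ ρ.toRingHom
      Module.Finite (SymmetricAlgebra k (dividedPower k U d)) (VeroneseTorSum 𝒜 i d) ∧
      Module.support (SymmetricAlgebra k (dividedPower k U d)) (VeroneseTorSum 𝒜 i d) ⊆
        PrimeSpectrum.zeroLocus (chowIdeal k U d : Set (SymmetricAlgebra k (dividedPower k U d)))) ∧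
    (∀ n, FiniteDimensional k (VeroneseTor 𝒜 i d n)) ∧
    ∃ P : Polynomial ℚ,
      (P = 0 ∨ (P.natDegree : ℤ) ≤ ((Module.finrank k U : ℤ) - 1) * d) ∧
      ∀ᶠ n : ℕ in Filter.atTop,
        (Module.finrank k (VeroneseTor 𝒜 i d n) : ℚ) = P.eval (n : ℚ) := by
  have hchow := exists_intertwines_chowMul_veroneseTor 𝒜 hπ hg (Module.finBasis k U) i d
  obtain ⟨act, hact, J, _, Q, hQ, h⟩ := hchow
  have halg := exists_algHom_forall_ι_eq_shiftMap act
    (Intertwines.comm hQ h fun s t n w => chowMul_comm s t n w)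
  obtain ⟨ρ₀, hρ₀⟩ := halg
  have iff_eq : ∀ ρ, IsMultiplicationAction 𝒜 g i d ρ ↔ ρ = ρ₀ := fun ρ => by
    simp only [isMultiplicationAction_iff, ← hact, ← hρ₀]
    exact ⟨algHom_ext_dpow, fun h u => h ▸ rfl⟩
  refine ⟨⟨ρ₀, (iff_eq ρ₀).2 rfl, fun ρ => (iff_eq ρ).1⟩, fun ρ hρ => ?_,
    fun n => (hQ n).finiteDimensional, exists_polynomial_finrank_of_intertwines_chowMul hQ h⟩
  obtain rfl := (iff_eq ρ).1 hρ
  let := Module.compHom (VeroneseTorSum 𝒜 i d) ρ.toRingHom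
  have : IsScalarTower k (SymmetricAlgebra k (dividedPower k U d)) (VeroneseTorSum 𝒜 i d) :=
    IsScalarTower.of_algebraMap_smul fun c x => LinearMap.congr_fun (ρ.commutes c) x
  have hshift : IsShiftAction act := fun t x => LinearMap.congr_fun (hρ₀ t) x
  exact ⟨hshift.finite_of_intertwines_chowMul hQ h, hshift.support_subset_zeroLocus_chowIdeal hQ h⟩

end

theorem mainTheorem1 {k R : Type u} {U : Type v} [Field k] [IsAlgClosed k]
    [AddCommGroup U] [Module k U] [FiniteDimensional k U]
    [CommRing R] [Algebra k R] (𝒜 : ℕ → Submodule k R) [GradedAlgebra 𝒜]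
    (π : SymmetricAlgebra k U →ₐ[k] R) (hπ : Function.Surjective π)
    (g : U →ₗ[k] 𝒜 1) (hg : ∀ u, π (SymmetricAlgebra.ι k U u) = g u) (i d : ℕ) :
    (∃! ρ : SymmetricAlgebra k (dividedPower k U d) →ₐ[k] Module.End k (VeroneseTorSum 𝒜 i d),
      IsMultiplicationAction 𝒜 g i d ρ) ∧
    (∀ ρ : SymmetricAlgebra k (dividedPower k U d) →ₐ[k] Module.End k (VeroneseTorSum 𝒜 i d),
      IsMultiplicationAction 𝒜 g i d ρ →
      letI : Module (SymmetricAlgebra k (dividedPower k U d)) (VeroneseTorSum 𝒜 i d) :=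
        Module.compHom _ ρ.toRingHom
      Module.Finite (SymmetricAlgebra k (dividedPower k U d)) (VeroneseTorSum 𝒜 i d) ∧
      Module.support (SymmetricAlgebra k (dividedPower k U d)) (VeroneseTorSum 𝒜 i d) ⊆
        PrimeSpectrum.zeroLocus (chowIdeal k U d : Set (SymmetricAlgebra k (dividedPower k U d)))) ∧
    (∀ n, FiniteDimensional k (VeroneseTor 𝒜 i d n)) ∧
    ∃ P : Polynomial ℚ,
      (P = 0 ∨ (P.natDegree : ℤ) ≤ ((Module.finrank k U : ℤ) - 1) * d) ∧
      ∀ᶠ n : ℕ in Filter.atTop,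
        (Module.finrank k (VeroneseTor 𝒜 i d n) : ℚ) = P.eval (n : ℚ) :=
  mainTheorem1_general 𝒜 π hπ g hg i d
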